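/- Let $B>0$. Let $(\lambda)_k=\lambda(\lambda+1)\cdots(\lambda+k-1)$ be the Pochhammer symbol, let $${}_1F_3(a;b_1,b_2,b_3;\nu)=\sum_{k=0}^{\infty}\frac{(a)_k}{(b_1)_k(b_2)_k(b_3)_k}\,\frac{\nu^k}{k!},$$ and for $u\in\mathbb{R}$ put $$z_1(u)={}_1F_3\left(-\tfrac14;\tfrac14,\tfrac12,\tfrac34;\tfrac{u^4}{256}\right),\quad z_2(u)=u,\quad z_3(u)=u^2\,{}_1F_3\left(\tfrac14;\tfrac34,\tfrac54,\tfrac32;\tfrac{u^4}{256}\right),\quad z_4(u)=u^3\,{}_1F_3\left(\tfrac12;\tfrac54,\tfrac32,\tfrac74;\tfrac{u^4}{256}\right).$$ For $t>0$ and $x\in\mathbb{R}$ define $y_1,\dots,y_4$ by $$\begin{bmatrix} y_1(t,x)\\ y_2(t,x)\\ y_3(t,x)\\ y_4(t,x)\end{bmatrix}=(Bt)^{1/4}\begin{bmatrix}0&\frac1{\sqrt2}&-1&\frac1{\sqrt2}\\ 1&-\frac1{\sqrt2}&0&\frac1{\sqrt2}\\ 0&\frac1{\sqrt2}&1&\frac1{\sqrt2}\\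 1&\frac1{\sqrt2}&0&-\frac1{\sqrt2}\end{bmatrix}\begin{bmatrix}\frac{1}{\Gamma(5/4)}z_1(u)\\ \frac1{\Gamma(1)}z_2(u)\\ \frac1{2\Gamma(3/4)}z_3(u)\\ \frac1{6\Gamma(1/2)}z_4(u)\end{bmatrix},\qquad u=\frac{x}{(Bt)^{1/4}}.$$ Then $y_1,\dots,y_4$ form a fundamental set of self-similar solutions of Mullins' equation $$y_t+B\,y_{xxxx}=0,\qquad x\in\mathbb{R}\setminus\{0\},\ t>0.$$ That is: each $y_i$ is a classical solution (differentiable in $t$, four times continuously differentiable in $x$) of the self-similar form $y(t,x)=(Bt)^{1/4}Z\big(x/(Bt)^{1/4}\big)$; the four functions are linearly independent over $\mathbb{R}$ on the domain $t>0$, $x\neq0$, and also on each of the domains $t>0,\ x>0$ and $t>0,\ x<0$; and on each of the latter two domains every classical solution of this self-similar form is a real linear combination of $y_1,\dots,y_4$. Moreover, for every $t>0$, $$\lim_{x\to\infty}y_1(t,x)=\lim_{x\to\infty}y_2(t,x)=0,\qquad \lim_{x\to-\infty}y_3(t,x)=\lim_{x\to-\infty}y_4(t,x)=0,$$ $$\lim_{x\to-\infty}y_1(t,x)=\lim_{x\to-\infty}y_2(t,x)=-\infty,\qquad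 \lim_{x\to\infty}y_3(t,x)=\infty,\quad \lim_{x\to\infty}y_4(t,x)=-\infty,$$ and furthermore $$\lim_{t\to0^+}y_1(t,x)=\lim_{t\to0^+}y_2(t,x)=0\quad\text{for every }x>0,\qquad \lim_{t\to0^+}y_3(t,x)=\lim_{t\to0^+}y_4(t,x)=0\quad\text{for every }x<0.$$ -/

import Mathlib

open Set Filter Topology

noncomputable section

namespace Mullins

/-- The Pochhammer symbol `(a)_k = a (a + 1) ⋯ (a + k - 1)`. -/
def poch (a : ℝ) (k : ℕ) : ℝ := (ascPochhammer ℝ k).eval a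

/-- The generalized hypergeometric function `₁F₃(a; b₁, b₂, b₃; ν)`. -/
def hyp13 (a b₁ b₂ b₃ ν : ℝ) : ℝ :=
  ∑' k : ℕ, poch a k / (poch b₁ k * poch b₂ k * poch b₃ k) * (ν ^ k / (k.factorial : ℝ))

def z₁ (u : ℝ) : ℝ := hyp13 (-1 / 4) (1 / 4) (1 / 2) (3 / 4) (u ^ 4 / 256)

def z₂ (u : ℝ) : ℝ := u

def z₃ (u : ℝ) : ℝ := u ^ 2 * hyp13 (1 / 4) (3 / 4) (5 / 4) (3 / 2) (u ^ 4 / 256)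

def z₄ (u : ℝ) : ℝ := u ^ 3 * hyp13 (1 / 2) (5 / 4) (3 / 2) (7 / 4) (u ^ 4 / 256)

/-- The coefficient matrix. -/
def D : Matrix (Fin 4) (Fin 4) ℝ :=
  !![0, 1 / √2, -1, 1 / √2;
     1, -(1 / √2), 0, 1 / √2;
     0, 1 / √2, 1, 1 / √2;
     1, 1 / √2, 0, -(1 / √2)]

/-- The vector of the Gamma-normalized functions `z₁, …, z₄`. -/
def w (u : ℝ) : Fin 4 → ℝ :=
  ![1 / Real.Gamma (5 / 4) * z₁ u,
    1 / Real.Gamma 1 * z₂ u,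
    1 / (2 * Real.Gamma (3 / 4)) * z₃ u,
    1 / (6 * Real.Gamma (1 / 2)) * z₄ u]

/-- `y B 0, y B 1, y B 2, y B 3` are the functions `y₁, y₂, y₃, y₄` of `(t, x)`. -/
def y (B : ℝ) (i : Fin 4) (t x : ℝ) : ℝ :=
  (B * t) ^ (1 / 4 : ℝ) * (D.mulVec (w (x / (B * t) ^ (1 / 4 : ℝ)))) i

/-- `f` is a classical solution of `f_t + B f_xxxx = 0` for `t > 0` and `x` in the open set `S`. -/
def IsSolution (B : ℝ) (S : Set ℝ) (f : ℝ → ℝ → ℝ) : Prop :=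
  (∀ t, 0 < t → ContDiffOn ℝ 4 (fun x => f t x) S) ∧
  ∀ t, 0 < t → ∀ x ∈ S,
    DifferentiableAt ℝ (fun s => f s x) t ∧
    deriv (fun s => f s x) t + B * iteratedDeriv 4 (fun ξ => f t ξ) x = 0

/-- `f(t, x) = (B t)^{1/4} Z(x / (B t)^{1/4})` for `t > 0` and `x ∈ S`, for some profile `Z`. -/
def IsSelfSimilar (B : ℝ) (S : Set ℝ) (f : ℝ → ℝ → ℝ) : Prop :=
  ∃ Z : ℝ → ℝ, ∀ t, 0 < t → ∀ x ∈ S,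
    f t x = (B * t) ^ (1 / 4 : ℝ) * Z (x / (B * t) ^ (1 / 4 : ℝ))

/-- Linear independence over `ℝ` of functions of `(t, x)` on the domain `(0, ∞) × S`. -/
def LinIndepOn (S : Set ℝ) (F : Fin 4 → ℝ → ℝ → ℝ) : Prop :=
  LinearIndependent ℝ fun i : Fin 4 => (Ioi (0 : ℝ) ×ˢ S).domRestrict fun p : ℝ × ℝ => F i p.1 p.2

/-- `F` is a fundamental set (a basis) of the self-similar solutions on `(0, ∞) × S`. -/
def IsFundamentalSet (B : ℝ) (S : Set ℝ) (F : Fin 4 → ℝ → ℝ → ℝ) : Prop :=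
  (∀ i, IsSolution B S (F i) ∧ IsSelfSimilar B S (F i)) ∧
  LinIndepOn S F ∧
  ∀ f : ℝ → ℝ → ℝ, IsSolution B S f → IsSelfSimilar B S f →
    ∃ c : Fin 4 → ℝ, ∀ t, 0 < t → ∀ x ∈ S, f t x = ∑ i, c i * F i t x

end Mullins

end

/-! Inserting `y = (B t)^{1/4} Z(x / (B t)^{1/4})` into the equation leaves the profile equation
`Z⁗ = (u Z' - Z) / 4`. A power series `∑ aₙ uⁿ / n!` solves it exactly when
`aₙ₊₄ = (n - 1) / 4 · aₙ`, and the solutions with a single nonzero initial value are the given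
hypergeometric functions. By uniqueness for linear equations the entire solutions are all the
solutions on any interval, so a fundamental set comes from four independent vectors of initial data.

For the decay, take `h` bounded on `[0, ∞)` with `h⁗ = h`, so that its Taylor coefficients `cₙ` have
period `4`, and with `c₁ = 0`. Expanding in powers of `u > 0` gives
`∫₀^∞ h(u s) (1 - exp (-s⁴)) / s² ds = J u - 1/4 ∑ cₙ Γ((n - 1) / 4) uⁿ / n!`, where `n ≠ 1` in the
sum and `J = ∫₀^∞ (h(s) - h(0)) / s² ds`. The right-hand side is a profile, and the left-hand side
tends to `0` as `u → ∞` by the Riemann–Lebesgue lemma. The choices `h(s) = cos s` and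
`h(s) = exp (-s) + sin s` give two profiles that span those of `y₁` and `y₂`. The reflection
`u ↦ -u` exchanges `y₁, y₂` with `-y₃, y₄`, and these grow because, from order two on, the
coefficients of `y₃` and `-y₄` are nonnegative. -/

open MeasureTheory
open scoped Nat

namespace Mullins

/-- The exponential generating function `∑ aₙ uⁿ / n!` of a real sequence, in which form all the
entire functions of the argument are given; it has the junk value `0` where the series diverges. -/
noncomputable def egf (a : ℕ → ℝ) (u : ℝ) : ℝ := ∑' n : ℕ, a n * (u ^ n / (n ! : ℝ))

/-- The exponential generating function of `a` converges on the whole real line, which makes it an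
entire function. -/
def IsEntire (a : ℕ → ℝ) : Prop := ∀ r : ℝ, Summable fun n : ℕ => a n * (r ^ n / (n ! : ℝ))

theorem IsEntire.hasSum_egf {a : ℕ → ℝ} (h : IsEntire a) (u : ℝ) :
    HasSum (fun n : ℕ => a n * (u ^ n / (n ! : ℝ))) (egf a u) :=
  (h u).hasSum

theorem IsEntire.shift {a : ℕ → ℝ} (h : IsEntire a) : IsEntire fun n => a (n + 1) := by
  intro r
  set R : ℝ := max |r| 1
  have hR : 1 ≤ R := le_max_right _ _
  refine Summable.of_norm_bounded ((summable_nat_add_iff 1).2 (h (2 * R))).abs fun n => ?_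
  rw [Real.norm_eq_abs, abs_mul, abs_mul]
  refine mul_le_mul_of_nonneg_left ?_ (abs_nonneg _)
  rw [abs_div, abs_div, abs_pow, abs_pow, Nat.abs_cast, Nat.abs_cast, Nat.factorial_succ,
    abs_of_nonneg (by positivity : 0 ≤ 2 * R), Nat.cast_mul,
    div_le_div_iff₀ (by positivity) (by positivity)]
  have hrR : |r| ^ n ≤ R ^ (n + 1) :=
    (pow_le_pow_left₀ (abs_nonneg r) (le_max_left _ _) n).trans (pow_le_pow_right₀ hR n.le_succ)
  have hn : ((n + 1 : ℕ) : ℝ) ≤ 2 ^ (n + 1) := mod_cast (Nat.lt_two_pow_self (n := n + 1)).le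
  calc |r| ^ n * (((n + 1 : ℕ) : ℝ) * n !) ≤ R ^ (n + 1) * (2 ^ (n + 1) * n !) := by gcongr
    _ = (2 * R) ^ (n + 1) * n ! := by rw [mul_pow]; ring

theorem IsEntire.shift_iterate {a : ℕ → ℝ} (h : IsEntire a) (k : ℕ) :
    IsEntire fun n => a (n + k) := by
  induction k with
  | zero => exact h
  | succ k ih => simpa only [add_assoc, add_comm 1 k] using ih.shift

theorem egf_zero (a : ℕ → ℝ) : egf a 0 = a 0 := by
  rw [egf, tsum_eq_single 0 fun n hn => by rw [zero_pow hn, zero_div, mul_zero]]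
  simp

theorem hasDerivAt_pow_succ_div_factorial (n : ℕ) (u : ℝ) :
    HasDerivAt (fun v : ℝ => v ^ (n + 1) / ((n + 1)! : ℝ)) (u ^ n / (n ! : ℝ)) u := by
  refine ((hasDerivAt_pow (n + 1) u).div_const ((n + 1)! : ℝ)).congr_deriv ?_
  have hn : (n : ℝ) + 1 ≠ 0 := by positivity
  rw [Nat.factorial_succ, Nat.add_sub_cancel]
  push_cast
  field_simp

theorem hasDerivAt_egf {a : ℕ → ℝ} (h : IsEntire a) (u : ℝ) :
    HasDerivAt (egf a) (egf (fun n => a (n + 1)) u) u := by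
  have hR : 0 < |u| + 1 := by positivity
  have htail : HasDerivAt (fun v => ∑' n : ℕ, a (n + 1) * (v ^ (n + 1) / ((n + 1)! : ℝ)))
      (egf (fun n => a (n + 1)) u) u := by
    refine hasDerivAt_tsum_of_isPreconnected (t := Metric.ball 0 (|u| + 1)) (y₀ := 0)
      (h.shift (|u| + 1)).abs Metric.isOpen_ball (convex_ball _ _).isPreconnected
      (fun n v _ => (hasDerivAt_pow_succ_div_factorial n v).const_mul _) (fun n v hv => ?_)
      (Metric.mem_ball_self hR) ((summable_nat_add_iff 1).2 (h 0)) (by simp)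
    have hv' : |v| ≤ |u| + 1 := by simpa using (mem_ball_zero_iff.1 hv).le
    rw [Real.norm_eq_abs, abs_mul, abs_mul, abs_div, abs_div, abs_pow, abs_pow, abs_of_pos hR]
    gcongr
  have hsplit : egf a = fun v => a 0 + ∑' n : ℕ, a (n + 1) * (v ^ (n + 1) / ((n + 1)! : ℝ)) := by
    funext v
    rw [egf, (h v).tsum_eq_zero_add]
    simp
  rw [hsplit]
  exact htail.const_add _

theorem deriv_egf {a : ℕ → ℝ} (h : IsEntire a) : deriv (egf a) = egf fun n => a (n + 1) :=
  funext fun u => (hasDerivAt_egf h u).deriv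

theorem iteratedDeriv_egf (k : ℕ) {a : ℕ → ℝ} (h : IsEntire a) :
    iteratedDeriv k (egf a) = egf fun n => a (n + k) := by
  induction k with
  | zero => exact iteratedDeriv_zero
  | succ k ih =>
    rw [iteratedDeriv_succ, ih, deriv_egf (h.shift_iterate k)]
    simp only [add_assoc, add_comm 1 k]

theorem contDiff_egf (k : ℕ) {a : ℕ → ℝ} (h : IsEntire a) : ContDiff ℝ k (egf a) := by
  refine contDiff_of_differentiable_iteratedDeriv fun m _ => ?_
  rw [iteratedDeriv_egf m h]
  exact fun u => (hasDerivAt_egf (h.shift_iterate m) u).differentiableAt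

theorem egf_add {a b : ℕ → ℝ} (ha : IsEntire a) (hb : IsEntire b) :
    egf (a + b) = egf a + egf b := by
  funext u
  simp only [egf, Pi.add_apply, add_mul]
  exact (ha u).tsum_add (hb u)

theorem egf_smul (c : ℝ) (a : ℕ → ℝ) : egf (c • a) = c • egf a := by
  funext u
  simp only [egf, Pi.smul_apply, smul_eq_mul, mul_assoc, tsum_mul_left]

theorem egf_neg_apply (a : ℕ → ℝ) (u : ℝ) : egf a (-u) = egf (fun n => (-1) ^ n * a n) u := by
  refine tsum_congr fun n => ?_
  rw [neg_pow]
  ring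

theorem hasSum_mul_deriv_egf {a : ℕ → ℝ} (h : IsEntire a) (u : ℝ) :
    HasSum (fun n : ℕ => n * a n * (u ^ n / (n ! : ℝ))) (u * deriv (egf a) u) := by
  have hterm (n : ℕ) : ((n + 1 : ℕ) : ℝ) * a (n + 1) * (u ^ (n + 1) / ((n + 1)! : ℝ)) =
      u * (a (n + 1) * (u ^ n / (n ! : ℝ))) := by
    rw [Nat.factorial_succ]
    push_cast
    have hn : (n : ℝ) + 1 ≠ 0 := by positivity
    field_simp
    ring
  rw [deriv_egf h, ← hasSum_nat_add_iff' 1]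
  simpa only [hterm, Finset.sum_range_one, Nat.cast_zero, zero_mul, sub_zero] using
    (h.shift.hasSum_egf u).mul_left u

theorem bddAbove_range_of_eventually_add_le {α : Type*} [LinearOrder α] {b : ℕ → α} {p : ℕ}
    (hp : 0 < p) (h : ∀ᶠ n in atTop, b (n + p) ≤ b n) : BddAbove (range b) := by
  obtain ⟨N, hN⟩ := eventually_atTop.1 h
  have : Nonempty α := ⟨b 0⟩
  obtain ⟨M, hM⟩ := ((finite_Iio (N + p)).image b).bddAbove
  refine ⟨M, forall_mem_range.2 fun n => ?_⟩
  induction n using Nat.strong_induction_on with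
  | _ n ih =>
    rcases lt_or_ge n (N + p) with hn | hn
    · exact hM (mem_image_of_mem b hn)
    · obtain ⟨m, rfl⟩ := Nat.exists_eq_add_of_le' (show p ≤ n by omega)
      exact (hN m (by omega)).trans (ih m (by omega))

theorem isEntire_of_bddAbove {a : ℕ → ℝ}
    (h : ∀ K, 0 ≤ K → BddAbove (range fun n : ℕ => |a n| * (K ^ n / (n ! : ℝ)))) : IsEntire a := by
  intro r
  obtain ⟨M, hM⟩ := h (2 * |r|) (by positivity)
  refine Summable.of_norm_bounded (summable_geometric_two.mul_left M) fun n => ?_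
  calc ‖a n * (r ^ n / (n ! : ℝ))‖ = |a n| * ((2 * |r|) ^ n / (n ! : ℝ)) * (1 / 2) ^ n := by
        rw [Real.norm_eq_abs, abs_mul, abs_div, abs_pow, Nat.abs_cast, mul_pow, one_div, inv_pow]
        field_simp
    _ ≤ M * (1 / 2) ^ n := by gcongr; exact hM (mem_range_self n)

theorem isEntire_of_abs_add_le {a : ℕ → ℝ} {p : ℕ} (hp : 2 ≤ p)
    (h : ∀ n, |a (n + p)| ≤ (n + 1) * |a n|) : IsEntire a := by
  refine isEntire_of_bddAbove fun K hK =>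
    bddAbove_range_of_eventually_add_le (by omega : 0 < p) ?_
  obtain ⟨N, hN⟩ := exists_nat_ge (K ^ p)
  filter_upwards [eventually_ge_atTop N] with n hn
  have hKn : K ^ p ≤ n + 2 := by
    have : (N : ℝ) ≤ n := mod_cast hn
    linarith
  have hfac : ((n : ℝ) + 2) * ((n + 1) * n !) ≤ (n + p)! := by
    have : (n + 2)! ≤ (n + p)! := Nat.factorial_le (by omega)
    simp only [Nat.factorial_succ] at this
    exact_mod_cast this
  calc |a (n + p)| * (K ^ (n + p) / ((n + p)! : ℝ))
      ≤ (n + 1) * |a n| * (K ^ n * (n + 2) / (((n : ℝ) + 2) * ((n + 1) * n !))) := by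
        rw [pow_add]; gcongr; exact h n
    _ = |a n| * (K ^ n / (n ! : ℝ)) := by field_simp

/-- The sequence with initial values `v` for which `egf` solves the profile equation
`Z⁗ = (u Z' - Z) / 4`. -/
noncomputable def profileCoeff (v : Fin 4 → ℝ) : ℕ → ℝ
  | 0 => v 0
  | 1 => v 1
  | 2 => v 2
  | 3 => v 3
  | n + 4 => ((n : ℝ) - 1) / 4 * profileCoeff v n

theorem profileCoeff_add_four (v : Fin 4 → ℝ) (n : ℕ) :
    profileCoeff v (n + 4) = ((n : ℝ) - 1) / 4 * profileCoeff v n := by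
  rw [profileCoeff]

theorem profileCoeff_val (v : Fin 4 → ℝ) (i : Fin 4) : profileCoeff v i = v i := by
  fin_cases i <;> rfl

theorem eq_profileCoeff {a : ℕ → ℝ} {v : Fin 4 → ℝ}
    (ha : ∀ n, a (n + 4) = ((n : ℝ) - 1) / 4 * a n) (hv : ∀ i : Fin 4, a i = v i) :
    a = profileCoeff v := by
  funext n
  induction n using Nat.strong_induction_on with
  | _ n ih =>
    rcases lt_or_ge n 4 with hn | hn
    · exact (hv ⟨n, hn⟩).trans (profileCoeff_val v ⟨n, hn⟩).symm
    · obtain ⟨m, rfl⟩ := Nat.exists_eq_add_of_le' hn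
      rw [ha, profileCoeff_add_four, ih m (by omega)]

theorem profileCoeff_add (v w : Fin 4 → ℝ) :
    profileCoeff (v + w) = profileCoeff v + profileCoeff w := by
  refine (eq_profileCoeff (fun n => ?_) fun i => ?_).symm
  · simp only [Pi.add_apply, profileCoeff_add_four, mul_add]
  · simp only [Pi.add_apply, profileCoeff_val]

theorem profileCoeff_smul (c : ℝ) (v : Fin 4 → ℝ) :
    profileCoeff (c • v) = c • profileCoeff v := by
  refine (eq_profileCoeff (fun n => ?_) fun i => ?_).symm
  · simp only [Pi.smul_apply, smul_eq_mul, profileCoeff_add_four]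
    ring
  · simp only [Pi.smul_apply, profileCoeff_val]

theorem isEntire_profileCoeff (v : Fin 4 → ℝ) : IsEntire (profileCoeff v) := by
  refine isEntire_of_abs_add_le (p := 4) (by norm_num) fun n => ?_
  rw [profileCoeff_add_four, abs_mul]
  gcongr
  rw [abs_le]
  constructor <;> linarith [n.cast_nonneg (α := ℝ)]

/-- The entire solution of the profile equation `Z⁗ = (u Z' - Z) / 4` with the initial data
`Z⁽ⁱ⁾(0) = v i`, as a linear function of `v`. -/
noncomputable def profile : (Fin 4 → ℝ) →ₗ[ℝ] ℝ → ℝ where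
  toFun v := egf (profileCoeff v)
  map_add' v w := by
    rw [profileCoeff_add, egf_add (isEntire_profileCoeff v) (isEntire_profileCoeff w)]
  map_smul' c v := by rw [profileCoeff_smul, egf_smul, RingHom.id_apply]

theorem profile_eq_egf (v : Fin 4 → ℝ) : profile v = egf (profileCoeff v) := rfl

theorem contDiff_profile (k : ℕ) (v : Fin 4 → ℝ) : ContDiff ℝ k (profile v) :=
  contDiff_egf k (isEntire_profileCoeff v)

theorem iteratedDeriv_profile_zero (v : Fin 4 → ℝ) (k : Fin 4) :
    iteratedDeriv k (profile v) 0 = v k := by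
  rw [profile_eq_egf, iteratedDeriv_egf k (isEntire_profileCoeff v), egf_zero, zero_add,
    profileCoeff_val]

theorem iteratedDeriv_four_profile (v : Fin 4 → ℝ) (u : ℝ) :
    iteratedDeriv 4 (profile v) u = (u * deriv (profile v) u - profile v u) / 4 := by
  have h := isEntire_profileCoeff v
  rw [profile_eq_egf, iteratedDeriv_egf 4 h]
  refine ((h.shift_iterate 4).hasSum_egf u).unique ?_
  have hterm (n : ℕ) : profileCoeff v (n + 4) * (u ^ n / (n ! : ℝ)) =
      (n * profileCoeff v n * (u ^ n / (n ! : ℝ)) -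
        profileCoeff v n * (u ^ n / (n ! : ℝ))) / 4 := by
    rw [profileCoeff_add_four]
    ring
  simpa only [hterm] using ((hasSum_mul_deriv_egf h u).sub (h.hasSum_egf u)).div_const 4

theorem profile_neg_apply (v : Fin 4 → ℝ) (u : ℝ) :
    profile v (-u) = profile (fun i => (-1) ^ (i : ℕ) * v i) u := by
  rw [profile_eq_egf, profile_eq_egf, egf_neg_apply]
  refine congrFun (congrArg egf (eq_profileCoeff (fun n => ?_) fun i => ?_)) u
  · rw [profileCoeff_add_four, pow_add]
    ring
  · rw [profileCoeff_val]

theorem profileCoeff_eq_zero {v : Fin 4 → ℝ} {j : Fin 4} (hv : ∀ i, i ≠ j → v i = 0) {n : ℕ}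
    (hn : n % 4 ≠ j) : profileCoeff v n = 0 := by
  induction n using Nat.strong_induction_on with
  | _ n ih =>
    rcases lt_or_ge n 4 with h | h
    · rw [← hv ⟨n, h⟩ (by rintro rfl; exact hn (Nat.mod_eq_of_lt h)),
        ← profileCoeff_val v ⟨n, h⟩]
    · obtain ⟨m, rfl⟩ := Nat.exists_eq_add_of_le' h
      rw [profileCoeff_add_four, ih m (by omega) (by omega), mul_zero]

theorem profile_single_one (u : ℝ) : profile (Pi.single 1 1) u = u := by
  have hcoeff : (Pi.single 1 1 : ℕ → ℝ) = profileCoeff (Pi.single 1 1) := by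
    refine eq_profileCoeff (fun n => ?_) fun i => ?_
    · rcases eq_or_ne n 1 with rfl | hn
      · simp
      · rw [Pi.single_eq_of_ne hn, Pi.single_eq_of_ne (by omega), mul_zero]
    · fin_cases i <;> rfl
  rw [profile_eq_egf, ← hcoeff, egf, tsum_eq_single 1]
  · simp
  · intro n hn
    rw [Pi.single_eq_of_ne hn, zero_mul]

theorem poch_succ (a : ℝ) (k : ℕ) : poch a (k + 1) = poch a k * (a + k) :=
  ascPochhammer_succ_eval k a

theorem poch_pos {a : ℝ} (ha : 0 < a) (k : ℕ) : 0 < poch a k := ascPochhammer_pos k a ha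

section Hypergeometric

variable {b₁ b₂ b₃ : ℝ} {j : Fin 4}

theorem profileCoeff_single_four_mul_add (h₁ : 0 < b₁) (h₂ : 0 < b₂) (h₃ : 0 < b₃)
    (hb : ∀ x : ℝ, (b₁ + x) * (b₂ + x) * (b₃ + x) * (1 + x) =
      (((j : ℕ) + 1) / 4 + x) * (((j : ℕ) + 2) / 4 + x) * (((j : ℕ) + 3) / 4 + x) *
        (((j : ℕ) + 4) / 4 + x)) (k : ℕ) :
    ((j : ℕ)! : ℝ) * profileCoeff (Pi.single j 1) (4 * k + j) =
      poch (((j : ℕ) - 1) / 4) k / (poch b₁ k * poch b₂ k * poch b₃ k) *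
        ((4 * k + j)! / (256 ^ k * k !)) := by
  induction k with
  | zero =>
    rw [mul_zero, zero_add, profileCoeff_val]
    simp [poch]
  | succ k ih =>
    have hfac : ((4 * (k + 1) + (j : ℕ))! : ℝ) =
        256 * ((b₁ + k) * (b₂ + k) * (b₃ + k) * (1 + k)) * (4 * k + (j : ℕ))! := by
      rw [hb, show 4 * (k + 1) + (j : ℕ) = 4 * k + j + 4 by ring]
      simp only [Nat.factorial_succ]
      push_cast
      ring
    have hp₁ := poch_pos h₁ k
    have hp₂ := poch_pos h₂ k
    have hp₃ := poch_pos h₃ k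
    rw [hfac, show 4 * (k + 1) + (j : ℕ) = 4 * k + j + 4 by ring, profileCoeff_add_four,
      mul_left_comm, ih, poch_succ, poch_succ, poch_succ, poch_succ, Nat.factorial_succ, pow_succ]
    push_cast
    field_simp
    ring

theorem pow_mul_hyp13_eq_profile (h₁ : 0 < b₁) (h₂ : 0 < b₂) (h₃ : 0 < b₃)
    (hb : ∀ x : ℝ, (b₁ + x) * (b₂ + x) * (b₃ + x) * (1 + x) =
      (((j : ℕ) + 1) / 4 + x) * (((j : ℕ) + 2) / 4 + x) * (((j : ℕ) + 3) / 4 + x) *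
        (((j : ℕ) + 4) / 4 + x)) (u : ℝ) :
    u ^ (j : ℕ) * hyp13 (((j : ℕ) - 1) / 4) b₁ b₂ b₃ (u ^ 4 / 256) =
      ((j : ℕ)! : ℝ) * profile (Pi.single j 1) u := by
  have hinj : Function.Injective fun k : ℕ => 4 * k + (j : ℕ) := fun k l hkl => by
    simp only at hkl
    omega
  have hsupp : (Function.support fun n : ℕ =>
      profileCoeff (Pi.single j 1) n * (u ^ n / (n ! : ℝ))) ⊆
      range fun k : ℕ => 4 * k + (j : ℕ) := by
    refine fun n hn => ⟨n / 4, ?_⟩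
    have hmod : n % 4 = j := by
      by_contra hnj
      exact left_ne_zero_of_mul hn (profileCoeff_eq_zero (fun i hi => Pi.single_eq_of_ne hi 1) hnj)
    simp only
    omega
  rw [profile_eq_egf, egf, ← hinj.tsum_eq hsupp, hyp13, ← tsum_mul_left, ← tsum_mul_left]
  refine tsum_congr fun k => ?_
  rw [← mul_assoc _ (profileCoeff _ _), profileCoeff_single_four_mul_add h₁ h₂ h₃ hb, pow_add,
    pow_mul, div_pow]
  field_simp

end Hypergeometric

theorem z₁_eq_profile (u : ℝ) : z₁ u = profile (Pi.single 0 1) u := by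
  have h := pow_mul_hyp13_eq_profile (b₁ := 1 / 4) (b₂ := 1 / 2) (b₃ := 3 / 4) (j := 0)
    (by norm_num) (by norm_num) (by norm_num) (fun x => by norm_num) u
  norm_num at h
  rw [← h, z₁, neg_div]

theorem z₂_eq_profile (u : ℝ) : z₂ u = profile (Pi.single 1 1) u := (profile_single_one u).symm

theorem z₃_eq_profile (u : ℝ) : z₃ u = 2 * profile (Pi.single 2 1) u := by
  have h := pow_mul_hyp13_eq_profile (b₁ := 3 / 4) (b₂ := 5 / 4) (b₃ := 3 / 2) (j := 2)
    (by norm_num) (by norm_num) (by norm_num) (fun x => by norm_num; ring) u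
  norm_num at h
  rw [← h, z₃]

theorem z₄_eq_profile (u : ℝ) : z₄ u = 6 * profile (Pi.single 3 1) u := by
  have h := pow_mul_hyp13_eq_profile (b₁ := 5 / 4) (b₂ := 3 / 2) (b₃ := 7 / 4) (j := 3)
    (by norm_num) (by norm_num) (by norm_num) (fun x => by norm_num; ring) u
  norm_num [Nat.factorial] at h
  rw [← h, z₄]

theorem w_apply (u : ℝ) (j : Fin 4) :
    w u j = 1 / Real.Gamma ((5 - (j : ℕ)) / 4) * profile (Pi.single j 1) u := by
  match j with
  | 0 => norm_num [w, z₁_eq_profile]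
  | 1 => norm_num [w, z₂_eq_profile]
  | 2 =>
    change 1 / (2 * Real.Gamma (3 / 4)) * z₃ u = _
    rw [z₃_eq_profile]
    norm_num
    ring
  | 3 =>
    change 1 / (6 * Real.Gamma (1 / 2)) * z₄ u = _
    rw [z₄_eq_profile]
    norm_num
    ring

section LinearODE

theorem eqOn_of_hasDerivAt_clm_apply {E : Type*} [NormedAddCommGroup E] [NormedSpace ℝ E]
    {S : Set ℝ} (hS : S.OrdConnected) {A : ℝ → E →L[ℝ] E} (hA : ContinuousOn A S) {f g : ℝ → E}
    (hf : ∀ t ∈ S, HasDerivAt f (A t (f t)) t) (hg : ∀ t ∈ S, HasDerivAt g (A t (g t)) t)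
    {t₀ : ℝ} (ht₀ : t₀ ∈ S) (h₀ : f t₀ = g t₀) : EqOn f g S := by
  have hlip (a b : ℝ) (hab : Icc a b ⊆ S) :
      ∃ K, ∀ t ∈ Icc a b, LipschitzOnWith K (A t) univ := by
    obtain ⟨K, hK⟩ := isCompact_Icc.exists_bound_of_continuousOn (hA.mono hab)
    refine ⟨K.toNNReal, fun t ht => ((A t).lipschitz.weaken ?_).lipschitzOnWith⟩
    exact NNReal.le_toNNReal_of_coe_le (hK t ht)
  intro t ht
  rcases le_total t t₀ with h | h
  · have hsub : Icc t t₀ ⊆ S := hS.out ht ht₀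
    obtain ⟨K, hK⟩ := hlip t t₀ hsub
    exact ODE_solution_unique_of_mem_Icc_left (fun s hs => hK s (Ioc_subset_Icc_self hs))
      (HasDerivAt.continuousOn fun s hs => hf s (hsub hs))
      (fun s hs => (hf s (hsub (Ioc_subset_Icc_self hs))).hasDerivWithinAt) (fun _ _ => mem_univ _)
      (HasDerivAt.continuousOn fun s hs => hg s (hsub hs))
      (fun s hs => (hg s (hsub (Ioc_subset_Icc_self hs))).hasDerivWithinAt) (fun _ _ => mem_univ _)
      h₀ (left_mem_Icc.2 h)
  · have hsub : Icc t₀ t ⊆ S := hS.out ht₀ ht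
    obtain ⟨K, hK⟩ := hlip t₀ t hsub
    exact ODE_solution_unique_of_mem_Icc_right (fun s hs => hK s (Ico_subset_Icc_self hs))
      (HasDerivAt.continuousOn fun s hs => hf s (hsub hs))
      (fun s hs => (hf s (hsub (Ico_subset_Icc_self hs))).hasDerivWithinAt) (fun _ _ => mem_univ _)
      (HasDerivAt.continuousOn fun s hs => hg s (hsub hs))
      (fun s hs => (hg s (hsub (Ico_subset_Icc_self hs))).hasDerivWithinAt) (fun _ _ => mem_univ _)
      h₀ (right_mem_Icc.2 h)

theorem hasDerivAt_iteratedDeriv {Z : ℝ → ℝ} {n k : ℕ} {u : ℝ} (h : ContDiffAt ℝ n Z u)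
    (hk : k < n) : HasDerivAt (iteratedDeriv k Z) (iteratedDeriv (k + 1) Z u) u := by
  rw [iteratedDeriv_succ]
  have hd := (contDiffWithinAt_univ.2 h).differentiableWithinAt_iteratedDerivWithin (m := k)
    (mod_cast hk) (by simp)
  rw [iteratedDerivWithin_univ] at hd
  exact (differentiableWithinAt_univ.1 hd).hasDerivAt

/-- The operator carrying the jet `(Z, Z', …, Z⁽ⁿ⁻¹⁾)` of a function with `Z⁽ⁿ⁾ = ∑ cᵢ Z⁽ⁱ⁾` to the
derivative of that jet. It turns the scalar equation into a first-order system. -/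
noncomputable def companion {n : ℕ} (c : Fin n → ℝ) : (Fin n → ℝ) →L[ℝ] Fin n → ℝ :=
  ContinuousLinearMap.pi fun k =>
    if h : (k : ℕ) + 1 < n then ContinuousLinearMap.proj ⟨k + 1, h⟩
    else ∑ i, c i • ContinuousLinearMap.proj i

variable {n : ℕ} {S : Set ℝ} {c : Fin n → ℝ → ℝ} {Z Z₁ Z₂ : ℝ → ℝ}

theorem continuousOn_companion (hc : ∀ i, ContinuousOn (c i) S) :
    ContinuousOn (fun u => companion fun i => c i u) S := by
  refine continuousOn_clm_apply.2 fun p => continuousOn_pi.2 fun k => ?_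
  by_cases h : (k : ℕ) + 1 < n
  · simpa [companion, h] using continuousOn_const
  · simpa [companion, h] using continuousOn_finsetSum _ fun i _ => (hc i).mul continuousOn_const

theorem hasDerivAt_jet {u : ℝ} (hZ : ContDiffAt ℝ n Z u)
    (h : iteratedDeriv n Z u = ∑ i : Fin n, c i u * iteratedDeriv i Z u) :
    HasDerivAt (fun s (k : Fin n) => iteratedDeriv k Z s)
      (companion (fun i => c i u) fun k => iteratedDeriv k Z u) u := by
  refine hasDerivAt_pi.2 fun k => (hasDerivAt_iteratedDeriv hZ k.2).congr_deriv ?_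
  by_cases hk : (k : ℕ) + 1 < n
  · simp [companion, hk]
  · have hkn : (k : ℕ) + 1 = n := by omega
    simp [companion, hkn, h]

theorem iteratedDeriv_eq_of_linear_ode (hS : IsOpen S) (hS' : S.OrdConnected)
    (hc : ∀ i, ContinuousOn (c i) S) (hZ₁ : ContDiffOn ℝ n Z₁ S) (hZ₂ : ContDiffOn ℝ n Z₂ S)
    (h₁ : ∀ u ∈ S, iteratedDeriv n Z₁ u = ∑ i : Fin n, c i u * iteratedDeriv i Z₁ u)
    (h₂ : ∀ u ∈ S, iteratedDeriv n Z₂ u = ∑ i : Fin n, c i u * iteratedDeriv i Z₂ u)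
    {u₀ : ℝ} (hu₀ : u₀ ∈ S) (h₀ : ∀ k : Fin n, iteratedDeriv k Z₁ u₀ = iteratedDeriv k Z₂ u₀)
    {u : ℝ} (hu : u ∈ S) (k : Fin n) : iteratedDeriv k Z₁ u = iteratedDeriv k Z₂ u :=
  congrFun (eqOn_of_hasDerivAt_clm_apply hS' (continuousOn_companion hc)
    (fun s hs => hasDerivAt_jet (hZ₁.contDiffAt (hS.mem_nhds hs)) (h₁ s hs))
    (fun s hs => hasDerivAt_jet (hZ₂.contDiffAt (hS.mem_nhds hs)) (h₂ s hs))
    hu₀ (funext h₀) hu) k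

end LinearODE

/-- `Z` solves the profile equation `Z⁗ = (u Z' - Z) / 4` classically on the open set `S`. -/
def IsProfileOn (S : Set ℝ) (Z : ℝ → ℝ) : Prop :=
  ContDiffOn ℝ 4 Z S ∧ ∀ u ∈ S, iteratedDeriv 4 Z u = (u * deriv Z u - Z u) / 4

theorem isProfileOn_profile (S : Set ℝ) (v : Fin 4 → ℝ) : IsProfileOn S (profile v) :=
  ⟨(contDiff_profile 4 v).contDiffOn, fun u _ => iteratedDeriv_four_profile v u⟩

theorem IsProfileOn.eqOn {S : Set ℝ} (hS : IsOpen S) (hS' : S.OrdConnected) {Z₁ Z₂ : ℝ → ℝ}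
    (h₁ : IsProfileOn S Z₁) (h₂ : IsProfileOn S Z₂) {u₀ : ℝ} (hu₀ : u₀ ∈ S)
    (h₀ : ∀ k : Fin 4, iteratedDeriv k Z₁ u₀ = iteratedDeriv k Z₂ u₀) : EqOn Z₁ Z₂ S := by
  let c : Fin 4 → ℝ → ℝ := ![fun _ => -1 / 4, fun u => u / 4, 0, 0]
  have hc : ∀ i, ContinuousOn (c i) S := by
    intro i
    fin_cases i <;> dsimp [c] <;> fun_prop
  have hsum {Z : ℝ → ℝ} (hZ : IsProfileOn S Z) (u : ℝ) (hu : u ∈ S) :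
      iteratedDeriv 4 Z u = ∑ i : Fin 4, c i u * iteratedDeriv i Z u := by
    rw [hZ.2 u hu]
    simp [c, Fin.sum_univ_four, iteratedDeriv_one]
    ring
  exact fun u hu => by
    simpa using iteratedDeriv_eq_of_linear_ode hS hS' hc h₁.1 h₂.1 (hsum h₁) (hsum h₂) hu₀ h₀ hu 0

/-- The jet `(Z, Z', Z'', Z''')` at `u₀` of the entire solution `Z = profile v`, as a function of
the jet `v` at `0`. -/
noncomputable def profileJet (u₀ : ℝ) : (Fin 4 → ℝ) →ₗ[ℝ] Fin 4 → ℝ where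
  toFun v k := iteratedDeriv k (profile v) u₀
  map_add' v w := by
    funext k
    rw [map_add, iteratedDeriv_add (contDiff_profile k v).contDiffAt
      (contDiff_profile k w).contDiffAt, Pi.add_apply]
  map_smul' c v := by
    funext k
    rw [map_smul, iteratedDeriv_const_smul_field, RingHom.id_apply, Pi.smul_apply]

theorem profileJet_injective (u₀ : ℝ) : Function.Injective (profileJet u₀) := by
  intro v w hvw
  have heq : profile v = profile w := (eqOn_univ _ _).1 <|
    (isProfileOn_profile univ v).eqOn isOpen_univ ordConnected_univ (isProfileOn_profile univ w)
      (mem_univ u₀) (congrFun hvw)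
  funext k
  rw [← iteratedDeriv_profile_zero v k, heq, iteratedDeriv_profile_zero]

theorem eq_of_eqOn_profile {S : Set ℝ} (hS : IsOpen S) (hS' : S.Nonempty) {v w : Fin 4 → ℝ}
    (h : EqOn (profile v) (profile w) S) : v = w := by
  obtain ⟨u₀, hu₀⟩ := hS'
  refine profileJet_injective u₀ (funext fun k => ?_)
  exact (h.eventuallyEq_of_mem (hS.mem_nhds hu₀)).iteratedDeriv_eq k

theorem IsProfileOn.exists_eqOn_profile {S : Set ℝ} (hS : IsOpen S) (hS' : S.OrdConnected)
    {Z : ℝ → ℝ} (hZ : IsProfileOn S Z) : ∃ v, EqOn Z (profile v) S := by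
  rcases S.eq_empty_or_nonempty with rfl | ⟨u₀, hu₀⟩
  · exact ⟨0, eqOn_empty _ _⟩
  obtain ⟨v, hv⟩ := LinearMap.injective_iff_surjective.1 (profileJet_injective u₀)
    fun k => iteratedDeriv k Z u₀
  exact ⟨v, hZ.eqOn hS hS' (isProfileOn_profile S v) hu₀ fun k => (congrFun hv k).symm⟩

/-- The length scale `(B t)^{1/4}` of the diffusion at time `t`. -/
noncomputable def scale (B t : ℝ) : ℝ := (B * t) ^ (1 / 4 : ℝ)

/-- The function of `(t, x)` of self-similar form with profile `Z`. -/
noncomputable def selfSimilar (B : ℝ) (Z : ℝ → ℝ) (t x : ℝ) : ℝ :=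
  scale B t * Z (x / scale B t)

section SelfSimilar

variable {B t x : ℝ} {S : Set ℝ} {Z : ℝ → ℝ}

theorem scale_pos (hB : 0 < B) (ht : 0 < t) : 0 < scale B t :=
  Real.rpow_pos_of_pos (mul_pos hB ht) _

theorem scale_pow_four (hB : 0 < B) (ht : 0 < t) : scale B t ^ 4 = B * t := by
  rw [scale, ← Real.rpow_natCast, ← Real.rpow_mul (mul_pos hB ht).le]
  norm_num

theorem scale_inv (hB : 0 < B) : scale B B⁻¹ = 1 := by
  rw [scale, mul_inv_cancel₀ hB.ne', Real.one_rpow]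

theorem selfSimilar_inv (hB : 0 < B) (Z : ℝ → ℝ) : selfSimilar B Z B⁻¹ = Z := by
  funext x
  rw [selfSimilar, scale_inv hB, one_mul, div_one]

theorem hasDerivAt_scale (hB : 0 < B) (ht : 0 < t) :
    HasDerivAt (scale B) (scale B t / (4 * t)) t := by
  have hBt : 0 < B * t := mul_pos hB ht
  refine (((hasDerivAt_id t).const_mul B).rpow_const (p := 1 / 4) (.inl hBt.ne')).congr_deriv ?_
  rw [id, mul_one, Real.rpow_sub hBt, Real.rpow_one, ← scale]
  field_simp

theorem hasDerivAt_selfSimilar (hB : 0 < B) (ht : 0 < t)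
    (hZ : DifferentiableAt ℝ Z (x / scale B t)) :
    HasDerivAt (fun s => selfSimilar B Z s x)
      (scale B t / (4 * t) *
        (Z (x / scale B t) - x / scale B t * deriv Z (x / scale B t))) t := by
  have hq := hasDerivAt_scale hB ht
  have hq0 : scale B t ≠ 0 := (scale_pos hB ht).ne'
  have hu : HasDerivAt (fun s => x / scale B s) _ t := (hasDerivAt_const t x).div hq hq0
  have hprod : HasDerivAt (fun s => selfSimilar B Z s x) _ t :=
    hq.fun_mul (hZ.hasDerivAt.comp t hu)
  refine hprod.congr_deriv ?_
  field_simp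
  ring

theorem iteratedDeriv_comp_mul_left (Z : ℝ → ℝ) (c : ℝ) (k : ℕ) :
    iteratedDeriv k (fun x => Z (c * x)) = fun x => c ^ k * iteratedDeriv k Z (c * x) := by
  induction k with
  | zero => simp
  | succ k ih =>
    funext x
    rw [iteratedDeriv_succ, ih, deriv_const_mul_field, deriv_comp_mul_left c (iteratedDeriv k Z),
      iteratedDeriv_succ, smul_eq_mul, pow_succ, mul_assoc]

theorem iteratedDeriv_selfSimilar (B : ℝ) (Z : ℝ → ℝ) (t x : ℝ) (k : ℕ) :
    iteratedDeriv k (selfSimilar B Z t) x =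
      scale B t * ((scale B t)⁻¹ ^ k * iteratedDeriv k Z (x / scale B t)) := by
  have hfun : selfSimilar B Z t = fun x => scale B t * (fun x => Z ((scale B t)⁻¹ * x)) x := by
    funext x
    rw [selfSimilar, div_eq_inv_mul]
  rw [hfun, iteratedDeriv_const_mul_field, iteratedDeriv_comp_mul_left, div_eq_inv_mul]

theorem deriv_add_iteratedDeriv_selfSimilar (hB : 0 < B) (ht : 0 < t)
    (hZ : DifferentiableAt ℝ Z (x / scale B t)) :
    deriv (fun s => selfSimilar B Z s x) t + B * iteratedDeriv 4 (selfSimilar B Z t) x =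
      scale B t / t * (iteratedDeriv 4 Z (x / scale B t) -
        (x / scale B t * deriv Z (x / scale B t) - Z (x / scale B t)) / 4) := by
  have hq0 : scale B t ≠ 0 := (scale_pos hB ht).ne'
  have hBq : B = scale B t ^ 4 / t := by rw [scale_pow_four hB ht]; field_simp
  rw [(hasDerivAt_selfSimilar hB ht hZ).deriv, iteratedDeriv_selfSimilar]
  nth_rewrite 5 [hBq]
  field_simp
  ring

theorem isSolution_selfSimilar_iff (hB : 0 < B) (hS : IsOpen S)
    (hdil : ∀ q, 0 < q → ∀ x ∈ S, x / q ∈ S) :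
    IsSolution B S (selfSimilar B Z) ↔ IsProfileOn S Z := by
  have hτ : 0 < B⁻¹ := inv_pos.2 hB
  constructor
  · rintro ⟨hsmooth, heq⟩
    have hZ : ContDiffOn ℝ 4 Z S := by simpa only [selfSimilar_inv hB] using hsmooth B⁻¹ hτ
    refine ⟨hZ, fun u hu => ?_⟩
    have hd : DifferentiableAt ℝ Z u :=
      (hZ.contDiffAt (hS.mem_nhds hu)).differentiableAt (by norm_num)
    have h := (heq B⁻¹ hτ u hu).2
    rw [deriv_add_iteratedDeriv_selfSimilar hB hτ (by rwa [scale_inv hB, div_one]), scale_inv hB,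
      div_one] at h
    exact sub_eq_zero.1 ((mul_eq_zero.1 h).resolve_left (by positivity))
  · rintro ⟨hZ, hode⟩
    have hmem {t x : ℝ} (ht : 0 < t) (hx : x ∈ S) : x / scale B t ∈ S :=
      hdil _ (scale_pos hB ht) x hx
    refine ⟨fun t ht => ?_, fun t ht x hx => ?_⟩
    · exact contDiffOn_const.mul (hZ.comp (contDiffOn_id.div_const _) fun x hx => hmem ht hx)
    · have hd : DifferentiableAt ℝ Z (x / scale B t) :=
        (hZ.contDiffAt (hS.mem_nhds (hmem ht hx))).differentiableAt (by norm_num)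
      refine ⟨(hasDerivAt_selfSimilar hB ht hd).differentiableAt, ?_⟩
      rw [deriv_add_iteratedDeriv_selfSimilar hB ht hd, hode _ (hmem ht hx), sub_self, mul_zero]

theorem IsSolution.congr {f g : ℝ → ℝ → ℝ} (hf : IsSolution B S f) (hS : IsOpen S)
    (h : ∀ t, 0 < t → ∀ x ∈ S, g t x = f t x) : IsSolution B S g := by
  refine ⟨fun t ht => (hf.1 t ht).congr (h t ht), fun t ht x hx => ?_⟩
  have htime : (fun s => g s x) =ᶠ[𝓝 t] fun s => f s x := by
    filter_upwards [lt_mem_nhds ht] with s hs using h s hs x hx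
  have hspace : (fun ξ => g t ξ) =ᶠ[𝓝 x] fun ξ => f t ξ := by
    filter_upwards [hS.mem_nhds hx] with ξ hξ using h t ht ξ hξ
  obtain ⟨hd, heq⟩ := hf.2 t ht x hx
  exact ⟨hd.congr_of_eventuallyEq htime, by rwa [htime.deriv_eq, hspace.iteratedDeriv_eq]⟩

end SelfSimilar

/-- The initial data at `0` of the profiles of `y₁, …, y₄`. -/
noncomputable def initialData (i j : Fin 4) : ℝ := D i j / Real.Gamma ((5 - (j : ℕ)) / 4)

theorem mulVec_w_apply (u : ℝ) (i : Fin 4) : D.mulVec (w u) i = profile (initialData i) u := by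
  have hsum : initialData i = ∑ j, initialData i j • Pi.single j 1 := pi_eq_sum_univ' _
  rw [hsum, map_sum, Finset.sum_apply, Matrix.mulVec, dotProduct]
  refine Finset.sum_congr rfl fun j _ => ?_
  rw [w_apply, initialData, map_smul, Pi.smul_apply, smul_eq_mul]
  ring

theorem y_eq_selfSimilar (B : ℝ) (i : Fin 4) : y B i = selfSimilar B (profile (initialData i)) := by
  funext t x
  rw [y, mulVec_w_apply, selfSimilar, scale]

theorem D_mul_transpose : D * D.transpose = (2 : ℝ) • 1 := by
  have h : (√2)⁻¹ * (√2)⁻¹ = (1 / 2 : ℝ) := by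
    rw [← mul_inv, Real.mul_self_sqrt zero_le_two, one_div]
  ext i j
  rw [Matrix.mul_apply, Fin.sum_univ_four]
  fin_cases i <;> fin_cases j <;> simp [D, h] <;> norm_num

theorem Gamma_five_sub_div_four_pos (j : Fin 4) : 0 < Real.Gamma ((5 - (j : ℕ)) / 4) := by
  have hj : ((j : ℕ) : ℝ) ≤ 3 := mod_cast Nat.le_of_lt_succ j.2
  exact Real.Gamma_pos_of_pos (by linarith)

theorem linearIndependent_initialData : LinearIndependent ℝ initialData := by
  let γ : Fin 4 → ℝ := fun j => (Real.Gamma ((5 - (j : ℕ)) / 4))⁻¹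
  have hD : IsUnit D := by
    refine .of_mul_eq_one ((1 / 2 : ℝ) • D.transpose) ?_
    rw [Matrix.mul_smul, D_mul_transpose, smul_smul, one_div_mul_cancel two_ne_zero, one_smul]
  have hγ : IsUnit (Matrix.diagonal γ) := by
    refine Matrix.isUnit_diagonal.2 (Pi.isUnit_iff.2 fun j => ?_)
    exact (inv_ne_zero (Gamma_five_sub_div_four_pos j).ne').isUnit
  have hrow : initialData = (D * Matrix.diagonal γ).row := by
    ext i j
    rw [Matrix.row_apply, Matrix.mul_diagonal, initialData, div_eq_mul_inv]
  rw [hrow, Matrix.linearIndependent_rows_iff_isUnit]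
  exact hD.mul hγ

theorem exists_eq_sum_smul_initialData (v : Fin 4 → ℝ) :
    ∃ c : Fin 4 → ℝ, v = ∑ i, c i • initialData i := by
  let b := basisOfLinearIndependentOfCardEqFinrank linearIndependent_initialData (by simp)
  exact ⟨b.repr v, by simpa [b] using (b.sum_repr v).symm⟩

theorem sum_mul_y (B : ℝ) (c : Fin 4 → ℝ) (t x : ℝ) :
    ∑ i, c i * y B i t x = selfSimilar B (profile (∑ i, c i • initialData i)) t x := by
  simp only [y_eq_selfSimilar, selfSimilar, map_sum, map_smul, Finset.sum_apply, Pi.smul_apply,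
    smul_eq_mul, Finset.mul_sum]
  exact Finset.sum_congr rfl fun i _ => by ring

section FundamentalSet

variable {B : ℝ} {S : Set ℝ}

theorem linIndepOn_y (hB : 0 < B) (hS : IsOpen S) (hS' : S.Nonempty) : LinIndepOn S (y B) := by
  refine Fintype.linearIndependent_iff.2 fun c hc => ?_
  refine Fintype.linearIndependent_iff.1 linearIndependent_initialData c
    (eq_of_eqOn_profile hS hS' fun x hx => ?_)
  have h := congrFun hc ⟨(B⁻¹, x), inv_pos.2 hB, hx⟩
  simp only [Finset.sum_apply, Pi.smul_apply, smul_eq_mul, Set.domRestrict_apply, sum_mul_y,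
    selfSimilar_inv hB] at h
  rw [h, map_zero, Pi.zero_apply, Pi.zero_apply]

theorem isSolution_y (hB : 0 < B) (hS : IsOpen S) (hdil : ∀ q, 0 < q → ∀ x ∈ S, x / q ∈ S)
    (i : Fin 4) : IsSolution B S (y B i) := by
  rw [y_eq_selfSimilar]
  exact (isSolution_selfSimilar_iff hB hS hdil).2 (isProfileOn_profile S _)

theorem isSelfSimilar_y (B : ℝ) (S : Set ℝ) (i : Fin 4) : IsSelfSimilar B S (y B i) :=
  ⟨profile (initialData i), fun t _ x _ => congrFun₂ (y_eq_selfSimilar B i) t x⟩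

theorem isFundamentalSet_y (hB : 0 < B) (hS : IsOpen S) (hne : S.Nonempty)
    (hconn : S.OrdConnected) (hdil : ∀ q, 0 < q → ∀ x ∈ S, x / q ∈ S) :
    IsFundamentalSet B S (y B) := by
  refine ⟨fun i => ⟨isSolution_y hB hS hdil i, isSelfSimilar_y B S i⟩, linIndepOn_y hB hS hne, ?_⟩
  rintro f hf ⟨Z, hfZ⟩
  have hZ : IsProfileOn S Z := (isSolution_selfSimilar_iff hB hS hdil).1 <|
    hf.congr hS fun t ht x hx => (hfZ t ht x hx).symm
  obtain ⟨v, hv⟩ := hZ.exists_eqOn_profile hS hconn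
  obtain ⟨c, rfl⟩ := exists_eq_sum_smul_initialData v
  refine ⟨c, fun t ht x hx => ?_⟩
  calc f t x = scale B t * Z (x / scale B t) := hfZ t ht x hx
    _ = ∑ i, c i * y B i t x := by
      rw [hv (hdil _ (scale_pos hB ht) x hx), sum_mul_y, selfSimilar]

end FundamentalSet

section HalfLine

theorem integrableOn_bdd_mul {S : Set ℝ} {f k : ℝ → ℝ} {C : ℝ} (hk : IntegrableOn k S)
    (hS : MeasurableSet S) (hf : Continuous f) (hC : ∀ s ∈ S, |f s| ≤ C) :
    IntegrableOn (fun s => f s * k s) S :=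
  Integrable.bdd_mul hk hf.aestronglyMeasurable ((ae_restrict_iff' hS).2 (ae_of_all _ hC))

theorem integrableOn_div_sq {g : ℝ → ℝ} (hg : Continuous g) {C M : ℝ}
    (hC : ∀ s, 0 < s → s ≤ 1 → |g s| ≤ C * s ^ 2) (hM : ∀ s, 0 < s → |g s| ≤ M) :
    IntegrableOn (fun s => g s / s ^ 2) (Ioi 0) := by
  have hc : ContinuousOn (fun s => g s / s ^ 2) (Ioi 0) :=
    hg.continuousOn.div (continuous_pow 2).continuousOn fun s hs => (pow_pos hs 2).ne'
  rw [← Ioc_union_Ioi_eq_Ioi (zero_le_one' ℝ)]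
  refine IntegrableOn.union ?_ ?_
  · have h : IntegrableOn (fun _ : ℝ => C) (Ioc 0 1) := integrableOn_const (by simp)
    refine h.mono' ((hc.mono Ioc_subset_Ioi_self).aestronglyMeasurable measurableSet_Ioc)
      ((ae_restrict_iff' measurableSet_Ioc).2 (ae_of_all _ fun s hs => ?_))
    have hs2 : 0 < s ^ 2 := pow_pos hs.1 2
    rw [Real.norm_eq_abs, abs_div, abs_of_pos hs2, div_le_iff₀ hs2]
    exact hC s hs.1 hs.2
  · have h := (integrableOn_Ioi_rpow_of_lt (a := -2) (by norm_num) one_pos).const_mul M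
    have hsub : Ioi (1 : ℝ) ⊆ Ioi 0 := Ioi_subset_Ioi zero_le_one
    refine h.mono' ((hc.mono hsub).aestronglyMeasurable measurableSet_Ioi)
      ((ae_restrict_iff' measurableSet_Ioi).2 (ae_of_all _ fun s hs => ?_))
    have hs0 : 0 < s := hsub hs
    rw [Real.norm_eq_abs, abs_div, abs_of_pos (pow_pos hs0 2), Real.rpow_neg hs0.le,
      Real.rpow_two, div_eq_mul_inv]
    exact mul_le_mul_of_nonneg_right (hM s hs0) (by positivity)

theorem integrableOn_comp_mul_div_sq {g : ℝ → ℝ}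
    (hg : IntegrableOn (fun s => g s / s ^ 2) (Ioi 0)) {u : ℝ} (hu : 0 < u) :
    IntegrableOn (fun s => g (u * s) / s ^ 2) (Ioi 0) := by
  have h := (integrableOn_Ioi_comp_mul_left_iff (fun s => g s / s ^ 2) 0 hu).2 (by rwa [mul_zero])
  refine IntegrableOn.congr_fun (h.const_mul (u ^ 2)) (fun s _ => ?_) measurableSet_Ioi
  field_simp

theorem integral_comp_mul_div_sq (g : ℝ → ℝ) {u : ℝ} (hu : 0 < u) :
    ∫ s in Ioi (0 : ℝ), g (u * s) / s ^ 2 = u * ∫ s in Ioi (0 : ℝ), g s / s ^ 2 := by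
  have h := integral_comp_mul_left_Ioi (fun s => g s / s ^ 2) 0 hu
  rw [mul_zero, smul_eq_mul] at h
  calc ∫ s in Ioi (0 : ℝ), g (u * s) / s ^ 2
      = u ^ 2 * ∫ s in Ioi (0 : ℝ), g (u * s) / (u * s) ^ 2 := by
        rw [← integral_const_mul]
        congr 1 with s
        field_simp
    _ = u * ∫ s in Ioi (0 : ℝ), g s / s ^ 2 := by
        rw [h]
        field_simp

theorem integral_Ioi_eq_zero_of_inv {g : ℝ → ℝ} (h : ∀ x, 0 < x → g x⁻¹ / x ^ 2 = -g x) :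
    ∫ x in Ioi (0 : ℝ), g x = 0 := by
  have hsub : ∫ x in Ioi (0 : ℝ), g x = ∫ x in Ioi (0 : ℝ), -g x := by
    rw [← integral_comp_rpow_Ioi g (p := -1) (by norm_num)]
    refine setIntegral_congr_fun measurableSet_Ioi fun x (hx : 0 < x) => ?_
    have hpow : x ^ ((-1 : ℝ) - 1) = (x ^ 2)⁻¹ := by
      rw [← Real.rpow_two, ← Real.rpow_neg hx.le]
      norm_num
    simp only [hpow, Real.rpow_neg_one, abs_neg, abs_one, one_mul, smul_eq_mul, ← h x hx]
    ring
  rw [integral_neg] at hsub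
  linarith

variable {p : ℕ}

theorem integrableOn_pow_mul_exp_neg_pow (hp : 0 < p) (n : ℕ) :
    IntegrableOn (fun s : ℝ => s ^ n * Real.exp (-s ^ p)) (Ioi 0) := by
  simpa only [Real.rpow_natCast] using integrableOn_rpow_mul_exp_neg_rpow (p := p) (s := n)
    (by linarith [Nat.cast_nonneg (α := ℝ) n]) (mod_cast hp)

theorem integral_pow_mul_exp_neg_pow (hp : 0 < p) (n : ℕ) :
    ∫ s in Ioi (0 : ℝ), s ^ n * Real.exp (-s ^ p) = 1 / p * Real.Gamma ((n + 1) / p) := by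
  simpa only [Real.rpow_natCast] using integral_rpow_mul_exp_neg_rpow (p := p) (q := n)
    (mod_cast hp) (by linarith [Nat.cast_nonneg (α := ℝ) n])

theorem hasSum_integral_mul_exp_neg_pow (hp : 0 < p) {a : ℕ → ℝ} {g : ℝ → ℝ}
    (hg : ∀ s, 0 < s → HasSum (fun n => a n * s ^ n) (g s))
    (ha : Summable fun n : ℕ => a n * Real.Gamma ((n + 1) / p)) :
    HasSum (fun n : ℕ => 1 / p * (a n * Real.Gamma ((n + 1) / p)))
      (∫ s in Ioi (0 : ℝ), g s * Real.exp (-s ^ p)) := by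
  set F : ℕ → ℝ → ℝ := fun n s => a n * (s ^ n * Real.exp (-s ^ p)) with hF
  have hint (n : ℕ) : ∫ s in Ioi (0 : ℝ), F n s = 1 / p * (a n * Real.Gamma ((n + 1) / p)) := by
    rw [integral_const_mul, integral_pow_mul_exp_neg_pow hp]
    ring
  have hnorm (n : ℕ) :
      ∫ s in Ioi (0 : ℝ), ‖F n s‖ = 1 / p * |a n * Real.Gamma ((n + 1) / p)| := by
    have hΓ : 0 < Real.Gamma (((n : ℝ) + 1) / p) := Real.Gamma_pos_of_pos (by positivity)
    have habs : ∫ s in Ioi (0 : ℝ), ‖F n s‖ =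
        ∫ s in Ioi (0 : ℝ), |a n| * (s ^ n * Real.exp (-s ^ p)) := by
      refine setIntegral_congr_fun measurableSet_Ioi fun s (hs : 0 < s) => ?_
      simp only [hF]
      rw [Real.norm_eq_abs, abs_mul, abs_of_pos (a := s ^ n * Real.exp (-s ^ p)) (by positivity)]
    rw [habs, integral_const_mul, integral_pow_mul_exp_neg_pow hp, abs_mul, abs_of_pos hΓ]
    ring
  have hsum := hasSum_integral_of_summable_integral_norm (μ := volume.restrict (Ioi 0)) (F := F)
    (fun n => (integrableOn_pow_mul_exp_neg_pow hp n).const_mul (a n))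
    (by simpa only [hnorm] using ha.abs.mul_left (1 / (p : ℝ)))
  have hg' : ∫ s in Ioi (0 : ℝ), ∑' n, F n s = ∫ s in Ioi (0 : ℝ), g s * Real.exp (-s ^ p) :=
    setIntegral_congr_fun measurableSet_Ioi fun s hs => by
      simpa only [hF, mul_assoc] using ((hg s hs).mul_right (Real.exp (-s ^ p))).tsum_eq
  simpa only [hint, hg'] using hsum

end HalfLine

/-- The kernel `(1 - exp (-s⁴)) / s²` on the half-line against which the decaying profiles are
transforms of bounded solutions of `h⁗ = h`. -/
noncomputable def kernel (s : ℝ) : ℝ := (1 - Real.exp (-s ^ 4)) / s ^ 2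

theorem one_sub_exp_neg_mem_Icc {x : ℝ} (hx : 0 ≤ x) :
    1 - Real.exp (-x) ∈ Icc 0 (min x 1) :=
  ⟨sub_nonneg.2 (Real.exp_le_one_iff.2 (neg_nonpos.2 hx)),
    le_min (sub_le_comm.1 (Real.one_sub_le_exp_neg x)) (sub_le_self _ (Real.exp_pos _).le)⟩

theorem kernel_nonneg (s : ℝ) : 0 ≤ kernel s :=
  div_nonneg (one_sub_exp_neg_mem_Icc (by positivity)).1 (sq_nonneg s)

theorem kernel_le_sq (s : ℝ) : kernel s ≤ s ^ 2 := by
  refine div_le_of_le_mul₀ (sq_nonneg s) (sq_nonneg s) ?_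
  exact ((one_sub_exp_neg_mem_Icc (by positivity)).2.trans (min_le_left _ _)).trans_eq (by ring)

theorem kernel_le_inv_sq (s : ℝ) : kernel s ≤ (s ^ 2)⁻¹ := by
  rw [kernel, div_eq_mul_inv]
  exact mul_le_of_le_one_left (by positivity)
    ((one_sub_exp_neg_mem_Icc (by positivity)).2.trans (min_le_right _ _))

theorem integrableOn_kernel : IntegrableOn kernel (Ioi 0) := by
  refine integrableOn_div_sq (C := 1) (M := 1) (by fun_prop) (fun s hs hs1 => ?_) fun s _ => ?_
  all_goals
    obtain ⟨h0, h1⟩ := one_sub_exp_neg_mem_Icc (by positivity : 0 ≤ s ^ 4)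
    rw [abs_of_nonneg h0]
  · rw [one_mul]
    exact (h1.trans (min_le_left _ _)).trans (pow_le_pow_of_le_one hs.le hs1 (by norm_num))
  · exact h1.trans (min_le_right _ _)

theorem hasDerivAt_mul_kernel {s : ℝ} (hs : s ≠ 0) :
    HasDerivAt (fun s => s * kernel s) (4 * (s ^ 2 * Real.exp (-s ^ 4)) - kernel s) s := by
  have hpow : HasDerivAt (fun s : ℝ => -s ^ 4) _ s := (hasDerivAt_pow 4 s).neg
  have hnum : HasDerivAt (fun s : ℝ => 1 - Real.exp (-s ^ 4)) _ s := hpow.exp.const_sub 1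
  have hker : HasDerivAt kernel _ s := hnum.div (hasDerivAt_pow 2 s) (pow_ne_zero 2 hs)
  refine ((hasDerivAt_id s).mul hker).congr_deriv ?_
  simp only [id, kernel]
  field_simp
  push_cast
  ring

theorem tendsto_mul_kernel_nhdsGE_zero : Tendsto (fun s => s * kernel s) (𝓝[≥] 0) (𝓝 0) := by
  have hbound : Tendsto (fun s : ℝ => s * s ^ 2) (𝓝[≥] 0) (𝓝 0) :=
    (Continuous.tendsto' (by fun_prop) 0 0 (by norm_num)).mono_left nhdsWithin_le_nhds
  refine tendsto_of_tendsto_of_tendsto_of_le_of_le' tendsto_const_nhds hbound ?_ ?_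
  · filter_upwards [self_mem_nhdsWithin] with s hs using mul_nonneg hs (kernel_nonneg s)
  · filter_upwards [self_mem_nhdsWithin] with s hs using
      mul_le_mul_of_nonneg_left (kernel_le_sq s) hs

theorem tendsto_mul_kernel_atTop : Tendsto (fun s => s * kernel s) atTop (𝓝 0) := by
  refine tendsto_of_tendsto_of_tendsto_of_le_of_le' tendsto_const_nhds tendsto_inv_atTop_zero ?_ ?_
  · filter_upwards [eventually_ge_atTop 0] with s hs using mul_nonneg hs (kernel_nonneg s)
  · filter_upwards [eventually_gt_atTop 0] with s hs
    calc s * kernel s ≤ s * (s ^ 2)⁻¹ := mul_le_mul_of_nonneg_left (kernel_le_inv_sq s) hs.le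
      _ = s⁻¹ := by field_simp

theorem integral_kernel : ∫ s in Ioi (0 : ℝ), kernel s = Real.Gamma (3 / 4) := by
  have hexp := (integrableOn_pow_mul_exp_neg_pow four_pos 2).const_mul 4
  have hparts : ∫ s in Ioi (0 : ℝ), (4 * (s ^ 2 * Real.exp (-s ^ 4)) - kernel s) = 0 := by
    refine (integral_Ioi_of_hasDerivAt_of_tendsto ?_ (fun s hs => hasDerivAt_mul_kernel
      (ne_of_gt hs)) (hexp.sub integrableOn_kernel) tendsto_mul_kernel_atTop).trans ?_
    · simpa only [ContinuousWithinAt, zero_mul] using tendsto_mul_kernel_nhdsGE_zero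
    · rw [zero_mul, sub_zero]
  rw [integral_sub hexp integrableOn_kernel, integral_const_mul,
    integral_pow_mul_exp_neg_pow four_pos, sub_eq_zero] at hparts
  rw [← hparts]
  norm_num
  ring

/-- The coefficients `cₙ Γ((n - 1) / 4)`: for a sequence `c` of period `4` they are those of a
profile, up to the factor `-1/4` the transform of `egf c` against `kernel`. The value `Γ(0) = 0`
at `n = 1` is junk, and is only used where `c 1 = 0`. -/
noncomputable def gammaCoeff (c : ℕ → ℝ) (n : ℕ) : ℝ := c n * Real.Gamma ((n - 1) / 4)

section PeriodicCoefficients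

variable {c : ℕ → ℝ}

theorem isEntire_of_periodic (hc : c.Periodic 4) : IsEntire c := by
  refine isEntire_of_abs_add_le (p := 4) (by norm_num) fun n => ?_
  rw [hc]
  exact le_mul_of_one_le_left (abs_nonneg _) (le_add_of_nonneg_left n.cast_nonneg)

theorem gammaCoeff_add_four (hc : c.Periodic 4) (h1 : c 1 = 0) (n : ℕ) :
    gammaCoeff c (n + 4) = ((n : ℝ) - 1) / 4 * gammaCoeff c n := by
  rcases eq_or_ne n 1 with rfl | hn
  · rw [gammaCoeff, hc, h1, Nat.cast_one, sub_self, zero_div, zero_mul, zero_mul]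
  · have hn0 : ((n : ℝ) - 1) / 4 ≠ 0 :=
      div_ne_zero (sub_ne_zero.2 (mod_cast hn)) four_ne_zero
    have harg : (((n + 4 : ℕ) : ℝ) - 1) / 4 = ((n : ℝ) - 1) / 4 + 1 := by push_cast; ring
    rw [gammaCoeff, gammaCoeff, hc, harg, Real.Gamma_add_one hn0]
    ring

theorem gammaCoeff_eq_profileCoeff (hc : c.Periodic 4) (h1 : c 1 = 0) :
    gammaCoeff c = profileCoeff fun i => gammaCoeff c i :=
  eq_profileCoeff (gammaCoeff_add_four hc h1) fun _ => rfl

theorem Gamma_neg_quarter : Real.Gamma (-1 / 4) = -4 * Real.Gamma (3 / 4) := by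
  have h := Real.Gamma_add_one (s := -1 / 4) (by norm_num)
  rw [show (-1 / 4 + 1 : ℝ) = 3 / 4 by norm_num] at h
  linarith

theorem integral_egf_sub_div_sq_mul_exp (hc : c.Periodic 4) (h1 : c 1 = 0) (u : ℝ) :
    ∫ s in Ioi (0 : ℝ), (egf c (u * s) - c 0) / s ^ 2 * Real.exp (-s ^ 4) =
      1 / 4 * egf (gammaCoeff c) u + c 0 * Real.Gamma (3 / 4) := by
  have hentire : IsEntire (gammaCoeff c) := by
    rw [gammaCoeff_eq_profileCoeff hc h1]
    exact isEntire_profileCoeff _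
  have hterm (n : ℕ) : c (n + 2) * (u ^ (n + 2) / ((n + 2)! : ℝ)) * Real.Gamma ((n + 1) / (4 : ℕ)) =
      gammaCoeff c (n + 2) * (u ^ (n + 2) / ((n + 2)! : ℝ)) := by
    rw [gammaCoeff, show (((n + 2 : ℕ) : ℝ) - 1) / 4 = (n + 1) / (4 : ℕ) by push_cast; ring]
    ring
  have htail : HasSum (fun n => gammaCoeff c (n + 2) * (u ^ (n + 2) / ((n + 2)! : ℝ)))
      (egf (gammaCoeff c) u - c 0 * Real.Gamma (-1 / 4)) := by
    simpa [Finset.sum_range_succ, gammaCoeff, h1, neg_div] using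
      (hasSum_nat_add_iff' 2).2 (hentire.hasSum_egf u)
  have hseries (s : ℝ) (hs : 0 < s) : HasSum
      (fun n => c (n + 2) * (u ^ (n + 2) / ((n + 2)! : ℝ)) * s ^ n)
      ((egf c (u * s) - c 0) / s ^ 2) := by
    have h := ((hasSum_nat_add_iff' 2).2
      ((isEntire_of_periodic hc).hasSum_egf (u * s))).div_const (s ^ 2)
    simp only [Finset.sum_range_succ, Finset.sum_range_zero, h1, pow_zero, Nat.factorial_zero,
      Nat.cast_one, div_one, mul_one, zero_mul, add_zero, zero_add] at h
    refine h.congr_fun fun n => ?_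
    rw [mul_pow, pow_add s n 2]
    field_simp
  have hint := hasSum_integral_mul_exp_neg_pow four_pos hseries
    (by simpa only [hterm] using htail.summable)
  simp only [hterm] at hint
  rw [hint.unique (htail.mul_left _), Gamma_neg_quarter]
  push_cast
  ring

theorem integral_egf_mul_kernel (hc : c.Periodic 4) (h1 : c 1 = 0)
    (hint : IntegrableOn (fun s => (egf c s - c 0) / s ^ 2) (Ioi 0)) {u : ℝ} (hu : 0 < u) :
    ∫ s in Ioi (0 : ℝ), egf c (u * s) * kernel s =
      u * (∫ s in Ioi (0 : ℝ), (egf c s - c 0) / s ^ 2) - 1 / 4 * egf (gammaCoeff c) u := by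
  have hi := integrableOn_comp_mul_div_sq (g := fun s => egf c s - c 0) hint hu
  have hi' : IntegrableOn (fun s => (egf c (u * s) - c 0) / s ^ 2 * Real.exp (-s ^ 4)) (Ioi 0) := by
    simp only [mul_comm _ (Real.exp _)]
    refine integrableOn_bdd_mul (C := 1) hi measurableSet_Ioi (by fun_prop) fun s _ => ?_
    rw [abs_of_pos (Real.exp_pos _)]
    exact Real.exp_le_one_iff.2 (neg_nonpos.2 (by positivity))
  have hdiff : IntegrableOn (fun s => (egf c (u * s) - c 0) / s ^ 2 -
      (egf c (u * s) - c 0) / s ^ 2 * Real.exp (-s ^ 4)) (Ioi 0) := hi.sub hi'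
  calc ∫ s in Ioi (0 : ℝ), egf c (u * s) * kernel s
      = ∫ s in Ioi (0 : ℝ), ((egf c (u * s) - c 0) / s ^ 2 -
          (egf c (u * s) - c 0) / s ^ 2 * Real.exp (-s ^ 4) + c 0 * kernel s) := by
        congr 1 with s
        rw [kernel]
        ring
    _ = u * (∫ s in Ioi (0 : ℝ), (egf c s - c 0) / s ^ 2) - 1 / 4 * egf (gammaCoeff c) u := by
        rw [integral_add hdiff (integrableOn_kernel.const_mul _), integral_sub hi hi',
          integral_const_mul, integral_kernel, integral_egf_sub_div_sq_mul_exp hc h1,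
          integral_comp_mul_div_sq (fun s => egf c s - c 0) hu]
        ring

theorem tendsto_profile_of_periodic (hc : c.Periodic 4) (h1 : c 1 = 0)
    (hint : IntegrableOn (fun s => (egf c s - c 0) / s ^ 2) (Ioi 0))
    (hlim : Tendsto (fun u => ∫ s in Ioi (0 : ℝ), egf c (u * s) * kernel s) atTop (𝓝 0)) :
    Tendsto (profile ![c 0 * Real.Gamma (-1 / 4), -4 * ∫ s in Ioi (0 : ℝ), (egf c s - c 0) / s ^ 2,
      c 2 * Real.Gamma (1 / 4), c 3 * Real.Gamma (1 / 2)]) atTop (𝓝 0) := by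
  set J : ℝ := ∫ s in Ioi (0 : ℝ), (egf c s - c 0) / s ^ 2
  have hdata : ![c 0 * Real.Gamma (-1 / 4), -4 * J, c 2 * Real.Gamma (1 / 4),
      c 3 * Real.Gamma (1 / 2)] = (fun i : Fin 4 => gammaCoeff c i) + (-4 * J) • Pi.single 1 1 := by
    funext i
    fin_cases i <;> norm_num [gammaCoeff, h1]
  have hlim' := hlim.const_mul (-4)
  rw [mul_zero] at hlim'
  refine hlim'.congr' ?_
  filter_upwards [eventually_gt_atTop 0] with u hu
  rw [integral_egf_mul_kernel hc h1 hint hu, hdata, map_add, map_smul, Pi.add_apply,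
    Pi.smul_apply, smul_eq_mul, profile_single_one, profile_eq_egf,
    ← gammaCoeff_eq_profileCoeff hc h1]
  ring

end PeriodicCoefficients

section Laplace

theorem integral_mul_exp_neg_mul {s : ℝ} (hs : 0 < s) :
    ∫ r in Ioi (0 : ℝ), r * Real.exp (-(s * r)) = (s ^ 2)⁻¹ := by
  have h := Real.integral_rpow_mul_exp_neg_mul_Ioi (a := 2) two_pos hs
  have hpow (r : ℝ) : r ^ ((2 : ℝ) - 1) = r := by norm_num
  simpa only [hpow, Real.Gamma_two, mul_one, Real.rpow_two, one_div, inv_pow] using h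

theorem integrableOn_mul_exp_neg_mul {s : ℝ} (hs : 0 < s) :
    IntegrableOn (fun r : ℝ => r * Real.exp (-(s * r))) (Ioi 0) :=
  Integrable.of_integral_ne_zero (by rw [integral_mul_exp_neg_mul hs]; positivity)

theorem integral_div_sq_eq_integral_laplace {g : ℝ → ℝ} (hg : Continuous g)
    (hint : IntegrableOn (fun s => g s / s ^ 2) (Ioi 0)) :
    ∫ s in Ioi (0 : ℝ), g s / s ^ 2 =
      ∫ r in Ioi (0 : ℝ), r * ∫ s in Ioi (0 : ℝ), g s * Real.exp (-(r * s)) := by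
  set f : ℝ → ℝ → ℝ := fun s r => g s * (r * Real.exp (-(s * r))) with hf
  have hfc : Continuous (Function.uncurry f) := by
    simp only [hf, Function.uncurry_def]
    fun_prop
  have hinner {s : ℝ} (hs : s ∈ Ioi (0 : ℝ)) : ∫ r in Ioi (0 : ℝ), ‖f s r‖ = |g s / s ^ 2| := by
    rw [abs_div, abs_of_nonneg (sq_nonneg s), div_eq_mul_inv, ← integral_mul_exp_neg_mul hs,
      ← integral_const_mul]
    refine setIntegral_congr_fun measurableSet_Ioi fun r (hr : 0 < r) => ?_
    rw [Real.norm_eq_abs, abs_mul, abs_of_pos (a := r * _) (by positivity)]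
  have hI : Integrable (Function.uncurry f)
      ((volume.restrict (Ioi 0)).prod (volume.restrict (Ioi 0))) := by
    refine (integrable_prod_iff hfc.aestronglyMeasurable).2
      ⟨(ae_restrict_iff' measurableSet_Ioi).2 (ae_of_all _ fun s hs =>
        (integrableOn_mul_exp_neg_mul hs).const_mul (g s)), ?_⟩
    exact IntegrableOn.congr_fun hint.abs (fun s hs => (hinner hs).symm) measurableSet_Ioi
  calc ∫ s in Ioi (0 : ℝ), g s / s ^ 2
      = ∫ s in Ioi (0 : ℝ), ∫ r in Ioi (0 : ℝ), f s r := by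
        refine setIntegral_congr_fun measurableSet_Ioi fun s hs => ?_
        rw [integral_const_mul, integral_mul_exp_neg_mul hs, div_eq_mul_inv]
    _ = ∫ r in Ioi (0 : ℝ), ∫ s in Ioi (0 : ℝ), f s r := integral_integral_swap hI
    _ = ∫ r in Ioi (0 : ℝ), r * ∫ s in Ioi (0 : ℝ), g s * Real.exp (-(r * s)) := by
        simp only [hf, ← integral_const_mul, mul_comm _ (_ : ℝ), mul_left_comm]

variable {r : ℝ}

theorem integrableOn_exp_neg_mul (hr : 0 < r) :
    IntegrableOn (fun s : ℝ => Real.exp (-(r * s))) (Ioi 0) := by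
  simpa only [neg_mul] using integrableOn_exp_mul_Ioi (neg_neg_of_pos hr) 0

theorem integral_exp_neg_mul (hr : 0 < r) : ∫ s in Ioi (0 : ℝ), Real.exp (-(r * s)) = r⁻¹ := by
  simpa [neg_mul] using integral_exp_mul_Ioi (neg_neg_of_pos hr) 0

theorem integrableOn_cos_mul_exp_neg_mul (hr : 0 < r) :
    IntegrableOn (fun s : ℝ => Real.cos s * Real.exp (-(r * s))) (Ioi 0) :=
  integrableOn_bdd_mul (integrableOn_exp_neg_mul hr) measurableSet_Ioi Real.continuous_cos
    fun s _ => Real.abs_cos_le_one s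

theorem integrableOn_sin_mul_exp_neg_mul (hr : 0 < r) :
    IntegrableOn (fun s : ℝ => Real.sin s * Real.exp (-(r * s))) (Ioi 0) :=
  integrableOn_bdd_mul (integrableOn_exp_neg_mul hr) measurableSet_Ioi Real.continuous_sin
    fun s _ => Real.abs_sin_le_one s

theorem re_neg_ofReal_add_I_neg (hr : 0 < r) : (-r + Complex.I : ℂ).re < 0 := by
  simpa using hr

theorem integral_cexp_neg_add_I_mul (hr : 0 < r) :
    ∫ s in Ioi (0 : ℝ), Complex.exp ((-r + Complex.I) * s) =
      (r / (r ^ 2 + 1) : ℝ) + (1 / (r ^ 2 + 1) : ℝ) * Complex.I := by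
  have hre := re_neg_ofReal_add_I_neg hr
  have hne : (-r + Complex.I : ℂ) ≠ 0 := fun h => by simp [h] at hre
  have hsq : (r : ℂ) ^ 2 + 1 ≠ 0 := mod_cast (by positivity : (0 : ℝ) < r ^ 2 + 1).ne'
  rw [integral_exp_mul_complex_Ioi hre 0, Complex.ofReal_zero, mul_zero, Complex.exp_zero,
    div_eq_iff hne]
  push_cast
  field_simp
  linear_combination -Complex.I_sq

theorem integral_cos_mul_exp_neg_mul (hr : 0 < r) :
    ∫ s in Ioi (0 : ℝ), Real.cos s * Real.exp (-(r * s)) = r / (r ^ 2 + 1) := by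
  have hre (s : ℝ) : (Complex.exp ((-r + Complex.I) * s)).re =
      Real.cos s * Real.exp (-(r * s)) := by
    simp [Complex.exp_re, mul_comm]
  have h := integral_re (integrableOn_exp_mul_complex_Ioi (re_neg_ofReal_add_I_neg hr) 0)
  simp only [RCLike.re_to_complex, hre] at h
  rw [h, integral_cexp_neg_add_I_mul hr, Complex.add_re, Complex.ofReal_re, Complex.re_ofReal_mul,
    Complex.I_re, mul_zero, add_zero]

theorem integral_sin_mul_exp_neg_mul (hr : 0 < r) :
    ∫ s in Ioi (0 : ℝ), Real.sin s * Real.exp (-(r * s)) = 1 / (r ^ 2 + 1) := by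
  have him (s : ℝ) : (Complex.exp ((-r + Complex.I) * s)).im =
      Real.sin s * Real.exp (-(r * s)) := by
    simp [Complex.exp_im, mul_comm]
  have h := integral_im (integrableOn_exp_mul_complex_Ioi (re_neg_ofReal_add_I_neg hr) 0)
  simp only [RCLike.im_to_complex, him] at h
  rw [h, integral_cexp_neg_add_I_mul hr, Complex.add_im, Complex.ofReal_im, Complex.im_ofReal_mul,
    Complex.I_im, mul_one, zero_add]

end Laplace

theorem integrableOn_cos_sub_one_div_sq :
    IntegrableOn (fun s : ℝ => (Real.cos s - 1) / s ^ 2) (Ioi 0) := by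
  refine integrableOn_div_sq (C := 1) (M := 2) (by fun_prop) (fun s _ _ => ?_) fun s _ => ?_
  all_goals
    rw [abs_sub_comm, abs_of_nonneg (sub_nonneg.2 (Real.cos_le_one s))]
  · linarith [Real.one_sub_sq_div_two_le_cos (x := s), sq_nonneg s]
  · linarith [Real.neg_one_le_cos s]

theorem integral_cos_sub_one_div_sq :
    ∫ s in Ioi (0 : ℝ), (Real.cos s - 1) / s ^ 2 = -(Real.pi / 2) := by
  rw [integral_div_sq_eq_integral_laplace (by fun_prop) integrableOn_cos_sub_one_div_sq]
  calc ∫ r in Ioi (0 : ℝ), r * ∫ s in Ioi (0 : ℝ), (Real.cos s - 1) * Real.exp (-(r * s))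
      = ∫ r in Ioi (0 : ℝ), -(1 + r ^ 2)⁻¹ := by
        refine setIntegral_congr_fun measurableSet_Ioi fun r (hr : 0 < r) => ?_
        simp only [sub_mul, one_mul]
        rw [integral_sub (integrableOn_cos_mul_exp_neg_mul hr) (integrableOn_exp_neg_mul hr),
          integral_cos_mul_exp_neg_mul hr, integral_exp_neg_mul hr]
        field_simp
        ring
    _ = -(Real.pi / 2) := by
        rw [integral_neg, integral_Ioi_inv_one_add_sq, Real.arctan_zero, sub_zero]

theorem integrableOn_exp_neg_add_sin_sub_one_div_sq :
    IntegrableOn (fun s : ℝ => (Real.exp (-s) + Real.sin s - 1) / s ^ 2) (Ioi 0) := by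
  refine integrableOn_div_sq (C := 2) (M := 3) (by fun_prop) (fun s hs hs1 => ?_) fun s hs => ?_
  · have hexp := abs_le.1 <| Real.abs_exp_sub_one_sub_id_le (x := -s) <| by
      rwa [abs_neg, abs_of_pos hs]
    rw [neg_sq] at hexp
    have hcube : s ^ 3 ≤ s ^ 2 := pow_le_pow_of_le_one hs.le hs1 (by norm_num)
    rw [abs_le]
    constructor <;>
      linarith [hexp.1, hexp.2, Real.sin_gt_sub_cube hs, Real.sin_lt hs, sq_nonneg s]
  · have hexp : Real.exp (-s) ≤ 1 := Real.exp_le_one_iff.2 (neg_nonpos.2 hs.le)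
    rw [abs_le]
    constructor <;> linarith [Real.exp_pos (-s), Real.neg_one_le_sin s, Real.sin_le_one s]

theorem integral_exp_neg_add_sin_sub_one_mul_exp_neg_mul {r : ℝ} (hr : 0 < r) :
    ∫ s in Ioi (0 : ℝ), (Real.exp (-s) + Real.sin s - 1) * Real.exp (-(r * s)) =
      (r + 1)⁻¹ + 1 / (r ^ 2 + 1) - r⁻¹ := by
  have hr1 : 0 < r + 1 := by positivity
  have hsplit (s : ℝ) : (Real.exp (-s) + Real.sin s - 1) * Real.exp (-(r * s)) =
      Real.exp (-((r + 1) * s)) + Real.sin s * Real.exp (-(r * s)) - Real.exp (-(r * s)) := by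
    rw [sub_mul, add_mul, ← Real.exp_add, one_mul, add_mul, one_mul, neg_add_rev]
  have hexp := integrableOn_exp_neg_mul hr1
  have hsin := integrableOn_sin_mul_exp_neg_mul hr
  have hadd : IntegrableOn (fun s => Real.exp (-((r + 1) * s)) +
      Real.sin s * Real.exp (-(r * s))) (Ioi 0) := hexp.add hsin
  simp only [hsplit]
  rw [integral_sub hadd (integrableOn_exp_neg_mul hr), integral_add hexp hsin,
    integral_exp_neg_mul hr1, integral_sin_mul_exp_neg_mul hr, integral_exp_neg_mul hr]

theorem integral_exp_neg_add_sin_sub_one_div_sq :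
    ∫ s in Ioi (0 : ℝ), (Real.exp (-s) + Real.sin s - 1) / s ^ 2 = 0 := by
  rw [integral_div_sq_eq_integral_laplace (by fun_prop) integrableOn_exp_neg_add_sin_sub_one_div_sq]
  refine integral_Ioi_eq_zero_of_inv fun r hr => ?_
  rw [integral_exp_neg_add_sin_sub_one_mul_exp_neg_mul hr,
    integral_exp_neg_add_sin_sub_one_mul_exp_neg_mul (inv_pos.2 hr)]
  field_simp
  ring

section RiemannLebesgue

theorem tendsto_integral_cexp_mul_I_mul (f : ℝ → ℂ) :
    Tendsto (fun u : ℝ => ∫ s, Complex.exp ((u * s : ℝ) * Complex.I) * f s) atTop (𝓝 0) := by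
  have hu : Tendsto (fun u : ℝ => -u / (2 * Real.pi)) atTop (cocompact ℝ) :=
    (tendsto_neg_atTop_atBot.atBot_div_const (by positivity)).mono_right atBot_le_cocompact
  refine ((Real.tendsto_integral_exp_smul_cocompact f).comp hu).congr fun u => ?_
  refine integral_congr_ae (ae_of_all _ fun s => ?_)
  simp only [Circle.smul_def, Real.fourierChar_apply, smul_eq_mul]
  congr 4
  field_simp

variable {S : Set ℝ} {k : ℝ → ℝ}

theorem tendsto_setIntegral_cexp_mul_I_mul (hS : MeasurableSet S) (f : ℝ → ℂ) :
    Tendsto (fun u : ℝ => ∫ s in S, Complex.exp ((u * s : ℝ) * Complex.I) * f s) atTop (𝓝 0) := by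
  refine (tendsto_integral_cexp_mul_I_mul (S.indicator f)).congr fun u => ?_
  rw [← integral_indicator hS]
  simp only [indicator_mul_right]

theorem integrableOn_cexp_mul_I_mul (hk : IntegrableOn k S) (u : ℝ) :
    IntegrableOn (fun s => Complex.exp ((u * s : ℝ) * Complex.I) * k s) S := by
  refine Integrable.bdd_mul (c := 1) hk.ofReal (by fun_prop : Continuous fun s : ℝ =>
    Complex.exp ((u * s : ℝ) * Complex.I)).aestronglyMeasurable (ae_of_all _ fun s => ?_)
  rw [Complex.norm_exp_ofReal_mul_I]

theorem tendsto_integral_cos_mul (hS : MeasurableSet S) (hk : IntegrableOn k S) :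
    Tendsto (fun u : ℝ => ∫ s in S, Real.cos (u * s) * k s) atTop (𝓝 0) := by
  refine ((Complex.continuous_re.tendsto 0).comp
    (tendsto_setIntegral_cexp_mul_I_mul hS fun s => k s)).congr fun u => ?_
  simpa only [Function.comp_apply, RCLike.re_to_complex, Complex.re_mul_ofReal,
    Complex.exp_ofReal_mul_I_re] using (integral_re (integrableOn_cexp_mul_I_mul hk u)).symm

theorem tendsto_integral_sin_mul (hS : MeasurableSet S) (hk : IntegrableOn k S) :
    Tendsto (fun u : ℝ => ∫ s in S, Real.sin (u * s) * k s) atTop (𝓝 0) := by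
  refine ((Complex.continuous_im.tendsto 0).comp
    (tendsto_setIntegral_cexp_mul_I_mul hS fun s => k s)).congr fun u => ?_
  simpa only [Function.comp_apply, RCLike.im_to_complex, Complex.im_mul_ofReal,
    Complex.exp_ofReal_mul_I_im] using (integral_im (integrableOn_cexp_mul_I_mul hk u)).symm

theorem exp_neg_mul_le_one {u s : ℝ} (hu : 0 ≤ u) (hs : s ∈ Ioi (0 : ℝ)) :
    |Real.exp (-(u * s))| ≤ 1 := by
  rw [Real.abs_exp]
  exact Real.exp_le_one_iff.2 (neg_nonpos.2 (mul_nonneg hu (le_of_lt hs)))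

theorem tendsto_integral_exp_neg_mul (hk : IntegrableOn k (Ioi 0)) :
    Tendsto (fun u : ℝ => ∫ s in Ioi (0 : ℝ), Real.exp (-(u * s)) * k s) atTop (𝓝 0) := by
  have hmeas (u : ℝ) : AEStronglyMeasurable (fun s : ℝ => Real.exp (-(u * s)) * k s)
      (volume.restrict (Ioi 0)) :=
    (by fun_prop : Continuous fun s : ℝ => Real.exp (-(u * s))).aestronglyMeasurable.mul
      hk.aestronglyMeasurable
  suffices h : Tendsto (fun u : ℝ => ∫ s in Ioi (0 : ℝ), Real.exp (-(u * s)) * k s) atTop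
      (𝓝 (∫ _ in Ioi (0 : ℝ), (0 : ℝ))) by simpa only [integral_zero] using h
  refine tendsto_integral_filter_of_dominated_convergence (fun s => |k s|)
    (Eventually.of_forall hmeas) ?_ hk.abs
    ((ae_restrict_iff' measurableSet_Ioi).2 (ae_of_all _ fun s hs => ?_))
  · filter_upwards [eventually_ge_atTop 0] with u hu
    refine (ae_restrict_iff' measurableSet_Ioi).2 (ae_of_all _ fun s hs => ?_)
    rw [Real.norm_eq_abs, abs_mul]
    exact mul_le_of_le_one_left (abs_nonneg _) (exp_neg_mul_le_one hu hs)
  · have hexp : Tendsto (fun u : ℝ => Real.exp (-(u * s))) atTop (𝓝 0) :=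
      Real.tendsto_exp_neg_atTop_nhds_zero.comp (tendsto_id.atTop_mul_const hs)
    simpa only [zero_mul] using hexp.mul_const (k s)

end RiemannLebesgue

section Decay

theorem hasSum_I_pow_mul (s : ℝ) :
    HasSum (fun n : ℕ => Complex.I ^ n * ((s ^ n / (n ! : ℝ) : ℝ) : ℂ))
      (Complex.exp (s * Complex.I)) := by
  have h := NormedSpace.expSeries_div_hasSum_exp ((s : ℂ) * Complex.I)
  rw [← Complex.exp_eq_exp_ℂ] at h
  refine h.congr_fun fun n => ?_
  push_cast
  rw [mul_pow]
  ring

theorem egf_I_pow_re : egf (fun n => (Complex.I ^ n).re) = Real.cos := by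
  funext s
  simpa only [egf, Complex.re_mul_ofReal, Complex.exp_ofReal_mul_I_re] using
    (Complex.hasSum_re (hasSum_I_pow_mul s)).tsum_eq

theorem egf_I_pow_im : egf (fun n => (Complex.I ^ n).im) = Real.sin := by
  funext s
  simpa only [egf, Complex.im_mul_ofReal, Complex.exp_ofReal_mul_I_im] using
    (Complex.hasSum_im (hasSum_I_pow_mul s)).tsum_eq

theorem egf_neg_one_pow (s : ℝ) : egf (fun n => (-1) ^ n) s = Real.exp (-s) := by
  have h := NormedSpace.expSeries_div_hasSum_exp (-s)
  rw [← Real.exp_eq_exp_ℝ] at h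
  rw [← h.tsum_eq]
  refine tsum_congr fun n => ?_
  rw [neg_pow s, mul_div_assoc]

theorem periodic_I_pow : (fun n : ℕ => Complex.I ^ n).Periodic 4 := fun n =>
  (pow_add _ _ _).trans (by rw [Complex.I_pow_four, mul_one])

theorem periodic_neg_one_pow : (fun n : ℕ => (-1 : ℝ) ^ n).Periodic 4 := fun n =>
  (pow_add _ _ _).trans (by rw [Even.neg_one_pow ⟨2, rfl⟩, mul_one])

theorem periodic_I_pow_im : (fun n : ℕ => (Complex.I ^ n).im).Periodic 4 :=
  periodic_I_pow.comp Complex.im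

theorem egf_neg_one_pow_add_I_pow_im (s : ℝ) :
    egf ((fun n => (-1) ^ n) + fun n => (Complex.I ^ n).im) s = Real.exp (-s) + Real.sin s := by
  rw [egf_add (isEntire_of_periodic periodic_neg_one_pow)
    (isEntire_of_periodic periodic_I_pow_im), egf_I_pow_im, Pi.add_apply, egf_neg_one_pow]

theorem tendsto_profile_cos :
    Tendsto (profile ![Real.Gamma (-1 / 4), 2 * Real.pi, -Real.Gamma (1 / 4), 0]) atTop (𝓝 0) := by
  have h := tendsto_profile_of_periodic (periodic_I_pow.comp Complex.re) (by simp)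
  have hpi : -4 * -(Real.pi / 2) = 2 * Real.pi := by ring
  simp only [Function.comp_def, egf_I_pow_re, pow_zero, Complex.one_re,
    integral_cos_sub_one_div_sq, hpi] at h
  convert h integrableOn_cos_sub_one_div_sq
    (tendsto_integral_cos_mul measurableSet_Ioi integrableOn_kernel) using 3 <;> simp

theorem tendsto_integral_exp_neg_add_sin_mul_kernel :
    Tendsto (fun u => ∫ s in Ioi (0 : ℝ), (Real.exp (-(u * s)) + Real.sin (u * s)) * kernel s)
      atTop (𝓝 0) := by
  have h := (tendsto_integral_exp_neg_mul integrableOn_kernel).add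
    (tendsto_integral_sin_mul measurableSet_Ioi integrableOn_kernel)
  rw [add_zero] at h
  refine h.congr' ?_
  filter_upwards [eventually_ge_atTop 0] with u hu
  simp only [add_mul]
  refine (integral_add ?_ ?_).symm
  · exact integrableOn_bdd_mul integrableOn_kernel measurableSet_Ioi (by fun_prop)
      fun s hs => exp_neg_mul_le_one hu hs
  · exact integrableOn_bdd_mul integrableOn_kernel measurableSet_Ioi (by fun_prop)
      fun s _ => Real.abs_sin_le_one _

theorem tendsto_profile_exp_neg_add_sin :
    Tendsto (profile ![Real.Gamma (-1 / 4), 0, Real.Gamma (1 / 4), -2 * Real.Gamma (1 / 2)]) atTop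
      (𝓝 0) := by
  have h := tendsto_profile_of_periodic (periodic_neg_one_pow.add periodic_I_pow_im) (by simp)
  simp only [egf_neg_one_pow_add_I_pow_im, Pi.add_apply, pow_zero, Complex.one_im, add_zero,
    integral_exp_neg_add_sin_sub_one_div_sq, mul_zero] at h
  convert h integrableOn_exp_neg_add_sin_sub_one_div_sq
    tendsto_integral_exp_neg_add_sin_mul_kernel using 3 <;> norm_num [pow_succ]

theorem inv_Gamma_one_sub {s : ℝ} (hs : Real.sin (Real.pi * s) ≠ 0) :
    (Real.Gamma (1 - s))⁻¹ = Real.Gamma s * Real.sin (Real.pi * s) / Real.pi := by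
  refine inv_eq_of_mul_eq_one_left ?_
  have h := Real.Gamma_mul_Gamma_one_sub s
  rw [eq_div_iff hs] at h
  rw [div_mul_eq_mul_div, div_eq_one_iff_eq Real.pi_ne_zero, mul_right_comm, h]

theorem inv_Gamma_five_quarters :
    (Real.Gamma (5 / 4))⁻¹ = -Real.Gamma (-1 / 4) / (√2 * Real.pi) := by
  have hsin : Real.sin (Real.pi * (-1 / 4)) = -(1 / √2) := by
    rw [← Real.sqrt_div_self', ← Real.sin_pi_div_four, ← Real.sin_neg]
    ring_nf
  have h := inv_Gamma_one_sub (s := -1 / 4) (by rw [hsin]; simp)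
  rw [hsin, show (1 : ℝ) - -1 / 4 = 5 / 4 by norm_num] at h
  rw [h]
  ring

theorem inv_Gamma_three_quarters :
    (Real.Gamma (3 / 4))⁻¹ = Real.Gamma (1 / 4) / (√2 * Real.pi) := by
  have hsin : Real.sin (Real.pi * (1 / 4)) = 1 / √2 := by
    rw [mul_one_div, Real.sin_pi_div_four, Real.sqrt_div_self']
  have h := inv_Gamma_one_sub (s := 1 / 4) (by rw [hsin]; simp)
  rw [hsin, show (1 : ℝ) - 1 / 4 = 3 / 4 by norm_num] at h
  rw [h]
  ring

theorem inv_Gamma_one_half : (Real.Gamma (1 / 2))⁻¹ = Real.Gamma (1 / 2) / Real.pi := by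
  rw [Real.Gamma_one_half_eq, Real.sqrt_div_self', one_div]

theorem inv_Gamma_five_sub_div_four (j : Fin 4) : (Real.Gamma ((5 - (j : ℕ)) / 4))⁻¹ =
    ![-Real.Gamma (-1 / 4), √2 * Real.pi, Real.Gamma (1 / 4), √2 * Real.Gamma (1 / 2)] j /
      (√2 * Real.pi) := by
  fin_cases j
  · norm_num [inv_Gamma_five_quarters]
  · norm_num
  · norm_num [inv_Gamma_three_quarters]
  · norm_num [inv_Gamma_one_half]
    field_simp

theorem initialData_zero : initialData 0 = (2 * √2 * Real.pi)⁻¹ •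
    (![Real.Gamma (-1 / 4), 2 * Real.pi, -Real.Gamma (1 / 4), 0] -
      ![Real.Gamma (-1 / 4), 0, Real.Gamma (1 / 4), -2 * Real.Gamma (1 / 2)]) := by
  funext j
  rw [initialData, div_eq_mul_inv, inv_Gamma_five_sub_div_four]
  fin_cases j <;> simp [D] <;> field_simp
  ring

theorem initialData_one : initialData 1 = -(2 * √2 * Real.pi)⁻¹ •
    (![Real.Gamma (-1 / 4), 2 * Real.pi, -Real.Gamma (1 / 4), 0] +
      ![Real.Gamma (-1 / 4), 0, Real.Gamma (1 / 4), -2 * Real.Gamma (1 / 2)]) := by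
  funext j
  rw [initialData, div_eq_mul_inv, inv_Gamma_five_sub_div_four]
  fin_cases j <;> simp [D] <;> field_simp
  ring

theorem tendsto_profile_initialData_zero_atTop :
    Tendsto (profile (initialData 0)) atTop (𝓝 0) := by
  have h := (tendsto_profile_cos.sub tendsto_profile_exp_neg_add_sin).const_smul
    (2 * √2 * Real.pi)⁻¹
  rw [initialData_zero, map_smul, map_sub]
  rwa [sub_zero, smul_zero] at h

theorem tendsto_profile_initialData_one_atTop :
    Tendsto (profile (initialData 1)) atTop (𝓝 0) := by
  have h := (tendsto_profile_cos.add tendsto_profile_exp_neg_add_sin).const_smul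
    (-(2 * √2 * Real.pi)⁻¹)
  rw [initialData_one, map_smul, map_add]
  rwa [add_zero, smul_zero] at h

end Decay

section Growth

variable {v : Fin 4 → ℝ}

theorem profileCoeff_nonneg (h0 : v 0 ≤ 0) (h2 : 0 ≤ v 2) (h3 : 0 ≤ v 3) {n : ℕ} (hn : 2 ≤ n) :
    0 ≤ profileCoeff v n := by
  induction n using Nat.strong_induction_on with
  | _ n ih =>
    match n with
    | 2 => exact h2
    | 3 => exact h3
    | 4 =>
      rw [profileCoeff_add_four v 0]
      exact mul_nonneg_of_nonpos_of_nonpos (by norm_num) h0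
    | 5 =>
      rw [profileCoeff_add_four v 1]
      norm_num
    | m + 6 =>
      rw [profileCoeff_add_four v (m + 2)]
      refine mul_nonneg ?_ (ih (m + 2) (by omega) (by omega))
      push_cast
      linarith [(Nat.cast_nonneg m : (0 : ℝ) ≤ m)]

theorem le_profile (h0 : v 0 ≤ 0) (h2 : 0 ≤ v 2) (h3 : 0 ≤ v 3) {u : ℝ} (hu : 0 ≤ u) :
    v 0 + v 1 * u + v 3 * (u ^ 3 / 6) ≤ profile v u := by
  calc v 0 + v 1 * u + v 3 * (u ^ 3 / 6)
      = ∑ n ∈ {0, 1, 3}, profileCoeff v n * (u ^ n / (n ! : ℝ)) := by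
        simp [profileCoeff, Nat.factorial, add_assoc]
    _ ≤ profile v u := by
        refine (isEntire_profileCoeff v u).sum_le_tsum _ fun n hn => ?_
        simp only [Finset.mem_insert, Finset.mem_singleton] at hn
        exact mul_nonneg (profileCoeff_nonneg h0 h2 h3 (by omega)) (by positivity)

theorem tendsto_profile_atTop (h0 : v 0 ≤ 0) (h2 : 0 ≤ v 2) (h3 : 0 < v 3) :
    Tendsto (profile v) atTop atTop := by
  have hsq : Tendsto (fun u : ℝ => v 1 + v 3 / 6 * u ^ 2) atTop atTop :=
    tendsto_atTop_add_const_left _ _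
      ((tendsto_pow_atTop two_ne_zero).const_mul_atTop (by positivity))
  have hcubic : Tendsto (fun u : ℝ => v 0 + u * (v 1 + v 3 / 6 * u ^ 2)) atTop atTop :=
    tendsto_atTop_add_const_left _ _ (tendsto_id.atTop_mul_atTop₀ hsq)
  refine tendsto_atTop_mono' _ ?_ hcubic
  filter_upwards [eventually_ge_atTop 0] with u hu
  linarith [le_profile h0 h2 h3.le hu]

theorem tendsto_profile_initialData_two_atTop :
    Tendsto (profile (initialData 2)) atTop atTop := by
  refine tendsto_profile_atTop (by simp [initialData, D]) ?_ ?_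
  · exact div_nonneg (by simp [D]) (Gamma_five_sub_div_four_pos 2).le
  · exact div_pos (by simp [D]) (Gamma_five_sub_div_four_pos 3)

theorem tendsto_profile_initialData_three_atTop :
    Tendsto (profile (initialData 3)) atTop atBot := by
  have h : Tendsto (profile (-initialData 3)) atTop atTop := by
    refine tendsto_profile_atTop (neg_nonpos.2 ?_) (by simp [initialData, D]) (neg_pos.2 ?_)
    · exact div_nonneg (by simp [D]) (Gamma_five_sub_div_four_pos 0).le
    · exact div_neg_of_neg_of_pos (by simp [D]) (Gamma_five_sub_div_four_pos 3)
  rw [map_neg] at h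
  exact tendsto_neg_atTop_iff.1 h

end Growth

section Reflection

theorem profile_initialData_zero_neg (u : ℝ) :
    profile (initialData 0) (-u) = -profile (initialData 2) u := by
  have hdata : (fun i : Fin 4 => (-1) ^ (i : ℕ) * initialData 0 i) = -initialData 2 := by
    funext j
    rw [Pi.neg_apply, initialData, initialData, ← mul_div_assoc, ← neg_div]
    congr 1
    fin_cases j <;> simp [D, pow_succ]
  rw [profile_neg_apply, hdata, map_neg, Pi.neg_apply]

theorem profile_initialData_one_neg (u : ℝ) :
    profile (initialData 1) (-u) = profile (initialData 3) u := by
  have hdata : (fun i : Fin 4 => (-1) ^ (i : ℕ) * initialData 1 i) = initialData 3 := by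
    funext j
    rw [initialData, initialData, ← mul_div_assoc]
    congr 1
    fin_cases j <;> simp [D, pow_succ]
  rw [profile_neg_apply, hdata]

theorem tendsto_profile_initialData_zero_atBot :
    Tendsto (profile (initialData 0)) atBot atBot := by
  rw [← tendsto_comp_neg_atTop_iff]
  simp only [profile_initialData_zero_neg]
  exact tendsto_neg_atBot_iff.2 tendsto_profile_initialData_two_atTop

theorem tendsto_profile_initialData_one_atBot :
    Tendsto (profile (initialData 1)) atBot atBot := by
  rw [← tendsto_comp_neg_atTop_iff]
  simpa only [profile_initialData_one_neg] using tendsto_profile_initialData_three_atTop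

theorem tendsto_profile_initialData_two_atBot :
    Tendsto (profile (initialData 2)) atBot (𝓝 0) := by
  have h := (tendsto_profile_initialData_zero_atTop.comp tendsto_neg_atBot_atTop).neg
  simpa only [Function.comp_def, profile_initialData_zero_neg, neg_neg, neg_zero] using h

theorem tendsto_profile_initialData_three_atBot :
    Tendsto (profile (initialData 3)) atBot (𝓝 0) := by
  have h := tendsto_profile_initialData_one_atTop.comp tendsto_neg_atBot_atTop
  simpa only [Function.comp_def, profile_initialData_one_neg] using h

end Reflection

section Limits

variable {B t x : ℝ} {Z : ℝ → ℝ} {l : Filter ℝ}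

theorem tendsto_div_scale_atTop (hB : 0 < B) (ht : 0 < t) :
    Tendsto (fun x => x / scale B t) atTop atTop :=
  tendsto_id.atTop_div_const (scale_pos hB ht)

theorem tendsto_div_scale_atBot (hB : 0 < B) (ht : 0 < t) :
    Tendsto (fun x => x / scale B t) atBot atBot :=
  tendsto_id.atBot_div_const (scale_pos hB ht)

theorem tendsto_selfSimilar_zero (hl : Tendsto (fun x => x / scale B t) l l)
    (hZ : Tendsto Z l (𝓝 0)) : Tendsto (selfSimilar B Z t) l (𝓝 0) := by
  have h := (hZ.comp hl).const_mul (scale B t)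
  rwa [mul_zero] at h

theorem tendsto_scale_nhdsGT_zero (hB : 0 < B) : Tendsto (scale B) (𝓝[>] 0) (𝓝[>] 0) := by
  refine tendsto_nhdsWithin_iff.2 ⟨?_, ?_⟩
  · have hc : Continuous (scale B) :=
      (continuous_const.mul continuous_id).rpow_const fun _ => Or.inr (by norm_num)
    have h0 : scale B 0 = 0 := by rw [scale, mul_zero, Real.zero_rpow (by norm_num)]
    exact (h0 ▸ hc.tendsto 0).mono_left nhdsWithin_le_nhds
  · filter_upwards [self_mem_nhdsWithin] with t ht using scale_pos hB ht

theorem tendsto_selfSimilar_nhdsGT_zero (hB : 0 < B)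
    (hl : Tendsto (fun q => x / q) (𝓝[>] 0) l) (hZ : Tendsto Z l (𝓝 0)) :
    Tendsto (fun t => selfSimilar B Z t x) (𝓝[>] 0) (𝓝 0) := by
  have hq := tendsto_scale_nhdsGT_zero hB
  have h := (tendsto_nhdsWithin_iff.1 hq).1.mul (hZ.comp (hl.comp hq))
  rwa [mul_zero] at h

theorem tendsto_div_nhdsGT_atTop (hx : 0 < x) : Tendsto (fun q => x / q) (𝓝[>] 0) atTop := by
  simpa only [div_eq_mul_inv] using tendsto_inv_nhdsGT_zero.const_mul_atTop hx

theorem tendsto_div_nhdsGT_atBot (hx : x < 0) : Tendsto (fun q => x / q) (𝓝[>] 0) atBot := by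
  simpa only [div_eq_mul_inv] using tendsto_inv_nhdsGT_zero.const_mul_atTop_of_neg hx

end Limits

end Mullins

theorem theorem3 (B : ℝ) (hB : 0 < B) :
    -- self-similar solutions on `t > 0`, `x ≠ 0`, linearly independent there
    (∀ i, Mullins.IsSolution B {0}ᶜ (Mullins.y B i) ∧
      Mullins.IsSelfSimilar B {0}ᶜ (Mullins.y B i)) ∧
    Mullins.LinIndepOn {0}ᶜ (Mullins.y B) ∧
    -- a fundamental set on either side of `x = 0`
    Mullins.IsFundamentalSet B (Ioi 0) (Mullins.y B) ∧
    Mullins.IsFundamentalSet B (Iio 0) (Mullins.y B) ∧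
    -- behaviour as `x → ±∞`
    (∀ t, 0 < t →
      Tendsto (fun x => Mullins.y B 0 t x) atTop (𝓝 0) ∧
      Tendsto (fun x => Mullins.y B 1 t x) atTop (𝓝 0) ∧
      Tendsto (fun x => Mullins.y B 2 t x) atBot (𝓝 0) ∧
      Tendsto (fun x => Mullins.y B 3 t x) atBot (𝓝 0) ∧
      Tendsto (fun x => Mullins.y B 0 t x) atBot atBot ∧
      Tendsto (fun x => Mullins.y B 1 t x) atBot atBot ∧
      Tendsto (fun x => Mullins.y B 2 t x) atTop atTop ∧
      Tendsto (fun x => Mullins.y B 3 t x) atTop atBot) ∧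
    -- behaviour as `t → 0`
    (∀ x, 0 < x →
      Tendsto (fun t => Mullins.y B 0 t x) (𝓝[>] 0) (𝓝 0) ∧
      Tendsto (fun t => Mullins.y B 1 t x) (𝓝[>] 0) (𝓝 0)) ∧
    (∀ x, x < 0 →
      Tendsto (fun t => Mullins.y B 2 t x) (𝓝[>] 0) (𝓝 0) ∧
      Tendsto (fun t => Mullins.y B 3 t x) (𝓝[>] 0) (𝓝 0)) := by
  open Mullins in
  refine ⟨fun i => ⟨isSolution_y hB isOpen_compl_singleton
      (fun q hq x hx => div_ne_zero hx hq.ne') i, isSelfSimilar_y B _ i⟩,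
    linIndepOn_y hB isOpen_compl_singleton ⟨1, one_ne_zero⟩,
    isFundamentalSet_y hB isOpen_Ioi nonempty_Ioi ordConnected_Ioi fun q hq x hx => div_pos hx hq,
    isFundamentalSet_y hB isOpen_Iio nonempty_Iio ordConnected_Iio
      fun q hq x hx => div_neg_of_neg_of_pos hx hq, ?_, ?_, ?_⟩ <;>
    simp only [y_eq_selfSimilar]
  · intro t ht
    have hq := scale_pos hB ht
    have htop := tendsto_div_scale_atTop hB ht
    have hbot := tendsto_div_scale_atBot hB ht
    exact ⟨tendsto_selfSimilar_zero htop tendsto_profile_initialData_zero_atTop,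
      tendsto_selfSimilar_zero htop tendsto_profile_initialData_one_atTop,
      tendsto_selfSimilar_zero hbot tendsto_profile_initialData_two_atBot,
      tendsto_selfSimilar_zero hbot tendsto_profile_initialData_three_atBot,
      (tendsto_profile_initialData_zero_atBot.comp hbot).const_mul_atBot hq,
      (tendsto_profile_initialData_one_atBot.comp hbot).const_mul_atBot hq,
      (tendsto_profile_initialData_two_atTop.comp htop).const_mul_atTop hq,
      (tendsto_profile_initialData_three_atTop.comp htop).const_mul_atBot hq⟩
  · intro x hx
    have hl := tendsto_div_nhdsGT_atTop hx
    exact ⟨tendsto_selfSimilar_nhdsGT_zero hB hl tendsto_profile_initialData_zero_atTop,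
      tendsto_selfSimilar_nhdsGT_zero hB hl tendsto_profile_initialData_one_atTop⟩
  · intro x hx
    have hl := tendsto_div_nhdsGT_atBot hx
    exact ⟨tendsto_selfSimilar_nhdsGT_zero hB hl tendsto_profile_initialData_two_atBot,
      tendsto_selfSimilar_nhdsGT_zero hB hl tendsto_profile_initialData_three_atBot⟩
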